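/- **Setting.** Let $d\ge 1$, $S=\{1,\dots,k\}$, and let $G$ be an undirected graph with vertex set $\mathbb Z^d\times S$, possibly with parallel edges and self-edges. Assume that $G$ is connected and locally finite, that it is periodic (the number of edges between $(x,i)$ and $(y,j)$ equals the number of edges between $(0,i)$ and $(y-x,j)$), that every vertex has the same degree $D$ (a self-edge counting once), and that $G$ has at least one self-edge. For $f:\mathbb Z^d\times S\to\mathbb C$ let $$(Af)(x,i)=D^{-1}\sum_{(y,j)\sim(x,i)}f(y,j),$$ each $(y,j)$ being counted as many times as there are edges from $(x,i)$ to $(y,j)$. Let $R^x(i,j)$ be the number of edges from $(0,i)$ to $(x,j)$. For $\alpha\in T^d=\mathbb R^d/\mathbb Z^d$ let $\xi^\alpha(x)=e^{2\pi i\alpha\cdot x}$ and let $Q(\alpha)=D^{-1}\sum_{x\in\mathbb Z^d}e^{2\pi i\alpha\cdot x}R^x$, a Hermitian $k\times k$ matrix. For every $\alpha$ let $v(\alpha,1),\dots,v(\alpha,k)$ be an orthonormal basis of eigenvectors of $Q(\alpha)$ with real eigenvalues $\lambda(\alpha,1),\dots,\lambda(\alpha,k)$; the choice is arbitrary (for instance,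 any measurable one). For $u:S\to\mathbb C$ let $c^u(\alpha,i)=\langle u,v(\alpha,i)\rangle$ be the coefficients of $u$, so that $\sum_i c^u(\alpha,i)v(\alpha,i)=u$. Write $(u\otimes g)(x,i)=g(x)u_i$, and let $\delta_a$ be the indicator function of $a\in\mathbb Z^d$ and $e_j$ the $j$-th standard basis vector. **Theorem.** Let $u:S\to\mathbb C$. Pointwise at each vertex, and with $d\alpha$ the Haar probability measure on $T^d$, let $$g^u=\int_{T^d}\sum_{i=1}^k \mathrm{Re}\left\{c^u(\alpha,i)(1-\lambda(\alpha,i))^{-1}\,v(\alpha,i)\otimes\xi^\alpha\right\}d\alpha,$$ and for $1\le j\le d$ let $$g^{u,j}=\int_{T^d}\sum_{i=1}^k \mathrm{Re}\left\{c^u(\alpha,i)(1-\lambda(\alpha,i))^{-1}(1-e^{-2\pi i\alpha_j})\,v(\alpha,i)\otimes\xi^\alpha\right\}d\alpha.$$ (The integrands are undefined at most at $\alpha=0$.) Then: (i) The integrand of $g^{u,j}$ is integrable at every vertex if $d\ge 2$ or $u$ is real-valued. The integrand of $g^u$ is integrable at every vertex if $d\ge 3$, or $d=2$ and $\sum_i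 u_i=0$, or $d=1$, $\sum_i u_i=0$ and $u$ is real-valued. (ii) If the integrals defining $g^u$ (respectively $g^{u,j}$) exist at every vertex, then $(I-A)g^u=(\mathrm{Re}\,u)\otimes\delta_0$ (respectively $(I-A)g^{u,j}=(\mathrm{Re}\,u)\otimes(\delta_0-\delta_{e_j})$). In particular, for real-valued $u$ the right-hand sides are $u\otimes\delta_0$ and $u\otimes(\delta_0-\delta_{e_j})$. (iii) If the integrals defining $g^u$ (respectively $g^{u,j}$) exist at every vertex, then $g^u$ (respectively $g^{u,j}$) is bounded. -/

import Mathlib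

open MeasureTheory

/-- A periodic lattice with vertex set `ℤ^d × {1, …, k}`. The graph is undirected and may have
parallel edges and self-edges; it is given by `mult p q`, the number of edges joining `p` and `q`.
A self-edge counts once in the degree of its vertex. -/
structure PeriodicLattice (d k : ℕ) where
  /-- number of edges between two vertices -/
  mult : (Fin d → ℤ) × Fin k → (Fin d → ℤ) × Fin k → ℕ
  /-- common degree of all vertices -/
  D : ℕ
  mult_symm : ∀ p q, mult p q = mult q p
  /-- invariance under translations by `ℤ^d` -/
  periodic : ∀ (x y : Fin d → ℤ) (i j : Fin k), mult (x, i) (y, j) = mult (0, i) (y - x, j)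
  locallyFinite : ∀ p, {q | mult p q ≠ 0}.Finite
  /-- every vertex has degree `D` -/
  regular : ∀ p, ∑ᶠ q, mult p q = D
  /-- any two vertices are joined by a path -/
  connected : ∀ p q, Relation.ReflTransGen (fun a b => mult a b ≠ 0) p q
  /-- there is at least one self-edge -/
  exists_selfEdge : ∃ p, mult p p ≠ 0

namespace PeriodicLattice

/-- The space `V_G` is the space of complex functions on vertices; `u ⊗ g` is the function
`(x, i) ↦ g x * u i`. -/
def tensor {d k : ℕ} (u : Fin k → ℂ) (g : (Fin d → ℤ) → ℂ) : (Fin d → ℤ) × Fin k → ℂ :=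
  fun p => g p.1 * u p.2

/-- The function `δ_a` on `ℤ^d`. -/
def delta {d : ℕ} (a : Fin d → ℤ) : (Fin d → ℤ) → ℂ := Pi.single a 1

/-- The character `ξ^α (x) = exp (2 π i α · x)`, for `α` in the torus `ℝ^d / ℤ^d`. -/
noncomputable def character {d : ℕ} (α : UnitAddTorus (Fin d)) : (Fin d → ℤ) → ℂ :=
  fun x => UnitAddTorus.mFourier x α

/-- Haar probability measure on the torus `ℝ^d / ℤ^d`. -/
noncomputable def torusHaar (d : ℕ) : Measure (UnitAddTorus (Fin d)) :=
  Measure.pi fun _ : Fin d => (AddCircle.haarAddCircle : Measure UnitAddCircle)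

variable {d k : ℕ} (G : PeriodicLattice d k)

/-- The adjacency operator: `(A f) p` is the average of `f` over the `D` edges at `p`. -/
noncomputable def adjacencyOp (f : (Fin d → ℤ) × Fin k → ℂ) : (Fin d → ℤ) × Fin k → ℂ :=
  fun p => (G.D : ℂ)⁻¹ * ∑ᶠ q, (G.mult p q : ℂ) * f q

/-- The matrix `R^x`, counting the edges from `(0, i)` to `(x, j)`. -/
def adjMatrix (x : Fin d → ℤ) : Matrix (Fin k) (Fin k) ℂ :=
  Matrix.of fun i j => (G.mult (0, i) (x, j) : ℂ)

/-- The symbol `Q(α) = D⁻¹ ∑_x exp (2 π i α · x) R^x`; in each entry the sum is finite. -/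
noncomputable def symbol (α : UnitAddTorus (Fin d)) : Matrix (Fin k) (Fin k) ℂ :=
  Matrix.of fun i j => (G.D : ℂ)⁻¹ * ∑ᶠ x, character α x * G.adjMatrix x i j

/-- `v` and `lam` choose, for every `α`, an ordered orthonormal basis of eigenvectors of `Q(α)`
(with respect to the standard Hermitian inner product) and the corresponding real eigenvalues. -/
def IsEigenSelection
    (v : UnitAddTorus (Fin d) → OrthonormalBasis (Fin k) ℂ (EuclideanSpace ℂ (Fin k)))
    (lam : UnitAddTorus (Fin d) → Fin k → ℝ) : Prop :=
  ∀ α i, (G.symbol α).mulVec (v α i).ofLp = (lam α i : ℂ) • (v α i).ofLp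

/-- The `i`-th coefficient `c^u` of `u` in an orthonormal basis. -/
noncomputable def coeff (b : OrthonormalBasis (Fin k) ℂ (EuclideanSpace ℂ (Fin k)))
    (u : Fin k → ℂ) (i : Fin k) : ℂ :=
  inner ℂ (b i) (WithLp.toLp 2 u)

/-- The integrand of `g^u` at the vertex `p`:
`∑_i Re (c^u(α, i) (1 - λ(α, i))⁻¹ (v(α, i) ⊗ ξ^α) p)`. -/
noncomputable def greenIntegrand
    (v : UnitAddTorus (Fin d) → OrthonormalBasis (Fin k) ℂ (EuclideanSpace ℂ (Fin k)))
    (lam : UnitAddTorus (Fin d) → Fin k → ℝ) (u : Fin k → ℂ)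
    (p : (Fin d → ℤ) × Fin k) (α : UnitAddTorus (Fin d)) : ℝ :=
  ∑ i, (coeff (v α) u i * (1 - (lam α i : ℂ))⁻¹ * tensor (v α i).ofLp (character α) p).re

/-- The integrand of `g^{u,j}` at the vertex `p`:
`∑_i Re (c^u(α, i) (1 - λ(α, i))⁻¹ (1 - exp (-2 π i α_j)) (v(α, i) ⊗ ξ^α) p)`. -/
noncomputable def greenDiffIntegrand
    (v : UnitAddTorus (Fin d) → OrthonormalBasis (Fin k) ℂ (EuclideanSpace ℂ (Fin k)))
    (lam : UnitAddTorus (Fin d) → Fin k → ℝ) (u : Fin k → ℂ) (j : Fin d)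
    (p : (Fin d → ℤ) × Fin k) (α : UnitAddTorus (Fin d)) : ℝ :=
  ∑ i, (coeff (v α) u i * (1 - (lam α i : ℂ))⁻¹ * (1 - (fourier (-1) (α j) : ℂ)) *
    tensor (v α i).ofLp (character α) p).re

/-- The function `g^u`, an integral over the torus at each vertex. -/
noncomputable def green
    (v : UnitAddTorus (Fin d) → OrthonormalBasis (Fin k) ℂ (EuclideanSpace ℂ (Fin k)))
    (lam : UnitAddTorus (Fin d) → Fin k → ℝ) (u : Fin k → ℂ) (p : (Fin d → ℤ) × Fin k) : ℝ :=
  ∫ α, greenIntegrand v lam u p α ∂torusHaar d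

/-- The function `g^{u,j}`, an integral over the torus at each vertex. -/
noncomputable def greenDiff
    (v : UnitAddTorus (Fin d) → OrthonormalBasis (Fin k) ℂ (EuclideanSpace ℂ (Fin k)))
    (lam : UnitAddTorus (Fin d) → Fin k → ℝ) (u : Fin k → ℂ) (j : Fin d)
    (p : (Fin d → ℤ) × Fin k) : ℝ :=
  ∫ α, greenDiffIntegrand v lam u j p α ∂torusHaar d

end PeriodicLattice

/-!
For `α ≠ 0` all eigenvalues of `Q(α)` differ from `1`, and the sum in the definition of `g^u` is
`(1 - Q(α))⁻¹ u`. Since `A (w ⊗ ξ^α) = (Q(α) w) ⊗ ξ^α`, applying `I - A` under the integral sign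
leaves `Re (u ⊗ ξ^α)`, respectively `Re ((1 - exp (-2 π i α_j)) u ⊗ ξ^α)`, whose integral is a
Fourier coefficient (`integral_multiplierIntegrand_sub_adjacencyOp`).

The analysis near `α = 0` goes through Cramer's rule: `(1 - Q)⁻¹ u` is the quotient of the
trigonometric polynomials `adj (1 - Q) u` and `det (1 - Q)`, which have real coefficients if `u` is
real.

* Lower bound for the denominator. The quadratic form of `1 - Q(α)` is a sum of squares over the
  edges. Telescoping along paths of the connected graph bounds it below by a multiple of `‖α‖ ^ 2`,
  and by a constant on vectors with vanishing coordinate sum (`exists_energy_lower_bound`). Hence at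
  most one eigenvalue is small and `det (1 - Q(α)) ≥ c ‖α‖ ^ 2` (`exists_detPoly_lower_bound`).
* Upper bounds for the numerator. The adjugate at `α = 0` has constant rows, so the numerator
  vanishes there if the coordinates of `u` sum to zero or if there is a factor
  `1 - exp (-2 π i α_j)`; it is then of order `‖α‖`. For real `u` its real part is a cosine
  polynomial, hence of order `‖α‖ ^ 2` (`exists_abs_re_sub_re_apply_zero_le`). As `‖α‖ ^ (-s)` is
  integrable for `s < d`, integrability follows.

Boundedness (`exists_abs_integral_le`): the part of the integrand that comes from `Im u` is odd in
`α`, so one may take `u` real. If the numerator `F` does not vanish at `0`, integrability at the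
vertices of one cell already makes `1 / det (1 - Q)` integrable, which dominates all the integrands;
if it vanishes, the singularity is of order one, which is integrable if `d ≥ 2`. The case `d = 1`
remains: with `z` the basic character, `F / det (1 - Q)` is a real multiple of `(z⁻¹ - 1)⁻¹` up to a
bounded function, `z ^ x (z⁻¹ - 1)⁻¹` differs from `(z⁻¹ - 1)⁻¹` by a geometric sum, and
`Re (z⁻¹ - 1)⁻¹ = -1 / 2` (`exists_abs_integral_le_of_circle`).
-/

namespace PeriodicLattice

open UnitAddTorus ComplexConjugate Matrix

/-! ### Trigonometric polynomials with real coefficients -/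

/-- The trigonometric polynomials with real coefficients on the torus `ℝ^d / ℤ^d`. -/
noncomputable def realTrigPoly (d : ℕ) : Subalgebra ℝ C(UnitAddTorus (Fin d), ℂ) :=
  Algebra.adjoin ℝ (Set.range mFourier)

lemma mFourier_mem_realTrigPoly {d : ℕ} (n : Fin d → ℤ) : mFourier n ∈ realTrigPoly d :=
  Algebra.subset_adjoin ⟨n, rfl⟩

@[elab_as_elim]
lemma realTrigPoly_induction {d : ℕ} {P : C(UnitAddTorus (Fin d), ℂ) → Prop}
    (char : ∀ n, P (mFourier n)) (zero : P 0) (add : ∀ f g, P f → P g → P (f + g))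
    (smul : ∀ (r : ℝ) f, P f → P (r • f)) {f : C(UnitAddTorus (Fin d), ℂ)}
    (hf : f ∈ realTrigPoly d) : P f := by
  have hclosure : (Submonoid.closure (Set.range (mFourier (d := Fin d))) :
      Set C(UnitAddTorus (Fin d), ℂ)) = Set.range mFourier := by
    refine subset_antisymm ?_ Submonoid.subset_closure
    intro x hx
    refine Submonoid.closure_induction (fun y hy => hy) ⟨0, mFourier_zero⟩ ?_ hx
    rintro _ _ _ _ ⟨m, rfl⟩ ⟨n, rfl⟩
    exact ⟨m + n, by ext; simp [mFourier_add]⟩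
  have hf' : f ∈ Submodule.span ℝ (Set.range (mFourier (d := Fin d))) := by
    rw [← hclosure, ← Algebra.adjoin_eq_span]
    exact hf
  refine Submodule.span_induction ?_ zero (fun f g _ _ => add f g) (fun r f _ => smul r f) hf'
  rintro _ ⟨n, rfl⟩
  exact char n

lemma norm_fourier_one_sub_one (t : UnitAddCircle) :
    4 * ‖t‖ ≤ ‖(fourier 1 t : ℂ) - 1‖ ∧ ‖(fourier 1 t : ℂ) - 1‖ ≤ 2 * Real.pi * ‖t‖ := by
  obtain ⟨x, hx, rfl⟩ : ∃ x : ℝ, |x| ≤ 1 / 2 ∧ (x : UnitAddCircle) = t := by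
    obtain ⟨y, rfl⟩ := QuotientAddGroup.mk_surjective t
    refine ⟨y - round y, abs_sub_round y, ?_⟩
    have : ((round y : ℝ) : UnitAddCircle) = 0 :=
      (AddCircle.coe_eq_zero_iff 1).2 ⟨round y, by simp⟩
    rw [AddCircle.coe_sub, this, sub_zero]
  have hn : ‖(x : UnitAddCircle)‖ = |x| :=
    (AddCircle.norm_coe_eq_abs_iff 1 one_ne_zero).2 (by simpa using hx)
  have he : (fourier 1 (x : UnitAddCircle) : ℂ) =
      Complex.exp (Complex.I * ((2 * Real.pi * x : ℝ))) := by
    rw [fourier_coe_apply]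
    congr 1
    push_cast
    ring
  have hs : ‖(fourier 1 (x : UnitAddCircle) : ℂ) - 1‖ = 2 * Real.sin (Real.pi * |x|) := by
    have h1 : 0 ≤ Real.sin (Real.pi * |x|) := by
      apply Real.sin_nonneg_of_nonneg_of_le_pi (by positivity)
      nlinarith [Real.pi_pos]
    rw [he, Complex.norm_exp_I_mul_ofReal_sub_one, Real.norm_eq_abs, abs_mul, abs_two]
    have h2 : 2 * Real.pi * x / 2 = Real.pi * x := by ring
    rw [h2]
    rcases abs_cases x with ⟨h, _⟩ | ⟨h, _⟩
    · rw [h] at h1 ⊢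
      rw [abs_of_nonneg h1]
    · rw [h] at h1 ⊢
      rw [mul_neg, Real.sin_neg] at h1 ⊢
      rw [abs_of_nonpos (by linarith)]
  rw [hs, hn]
  constructor
  · have := Real.mul_le_sin (x := Real.pi * |x|) (by positivity) (by nlinarith [Real.pi_pos])
    have h3 : 2 / Real.pi * (Real.pi * |x|) = 2 * |x| := by field_simp
    linarith
  · have := Real.sin_le (x := Real.pi * |x|) (by positivity)
    linarith

lemma norm_fourier_sub_one_le (m : ℤ) (t : UnitAddCircle) :
    ‖(fourier m t : ℂ) - 1‖ ≤ 2 * Real.pi * |(m : ℝ)| * ‖t‖ := by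
  have h1 : (fourier m t : ℂ) = fourier 1 (m • t) := by simp [fourier_apply]
  rw [h1]
  refine (norm_fourier_one_sub_one _).2.trans ?_
  have := norm_zsmul_le (n := m) (a := t)
  rw [Int.norm_eq_abs] at this
  nlinarith [Real.pi_pos]

lemma norm_mFourier_apply {d : ℕ} (n : Fin d → ℤ) (α : UnitAddTorus (Fin d)) :
    ‖mFourier n α‖ = 1 := by
  simp [mFourier, fourier_apply, norm_prod, Circle.norm_coe]

lemma mFourier_apply_zero {d : ℕ} (n : Fin d → ℤ) : mFourier n 0 = 1 := by
  simp [mFourier]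

lemma exists_norm_mFourier_sub_one_le {d : ℕ} (n : Fin d → ℤ) :
    ∃ C : ℝ, 0 ≤ C ∧ ∀ α : UnitAddTorus (Fin d), ‖mFourier n α - 1‖ ≤ C * ‖α‖ := by
  refine ⟨∑ i, 2 * Real.pi * |(n i : ℝ)|, by positivity, fun α => ?_⟩
  have key : ∀ s : Finset (Fin d), ‖∏ i ∈ s, (fourier (n i) (α i) : ℂ) - 1‖ ≤
      ∑ i ∈ s, 2 * Real.pi * |(n i : ℝ)| * ‖α‖ := by
    intro s
    induction s using Finset.induction_on with
    | empty => simp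
    | insert a s ha ih =>
      rw [Finset.prod_insert ha, Finset.sum_insert ha]
      have h1 : (fourier (n a) (α a) : ℂ) * ∏ i ∈ s, (fourier (n i) (α i) : ℂ) - 1 =
          fourier (n a) (α a) * (∏ i ∈ s, (fourier (n i) (α i) : ℂ) - 1) +
            (fourier (n a) (α a) - 1) := by ring
      rw [h1]
      refine (norm_add_le _ _).trans ?_
      rw [norm_mul, add_comm]
      have h2 : ‖(fourier (n a) (α a) : ℂ)‖ = 1 := by
        simp only [fourier_apply, Circle.norm_coe]
      rw [h2, one_mul]
      refine add_le_add ((norm_fourier_sub_one_le _ _).trans ?_) ih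
      gcongr
      exact norm_le_pi_norm α a
  have := key Finset.univ
  rwa [← Finset.sum_mul] at this

/-- Real coefficients make conjugation and reflection agree. -/
lemma realTrigPoly_apply_neg {d : ℕ} {f : C(UnitAddTorus (Fin d), ℂ)} (hf : f ∈ realTrigPoly d)
    (α : UnitAddTorus (Fin d)) : f (-α) = conj (f α) := by
  refine realTrigPoly_induction (P := fun f => f (-α) = conj (f α)) ?_ ?_ ?_ ?_ hf
  · intro n
    rw [← mFourier_neg]
    simp [mFourier, fourier_apply]
  · simp
  · intro f g h1 h2
    simp [h1, h2]
  · intro r f h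
    simp [h]

lemma realTrigPoly_im_apply_zero {d : ℕ} {f : C(UnitAddTorus (Fin d), ℂ)}
    (hf : f ∈ realTrigPoly d) : (f 0).im = 0 := by
  have := realTrigPoly_apply_neg hf 0
  rw [neg_zero] at this
  exact Complex.conj_eq_iff_im.1 this.symm

lemma exists_norm_sub_apply_zero_le {d : ℕ} {f : C(UnitAddTorus (Fin d), ℂ)}
    (hf : f ∈ realTrigPoly d) : ∃ C : ℝ, 0 ≤ C ∧ ∀ α, ‖f α - f 0‖ ≤ C * ‖α‖ := by
  refine realTrigPoly_induction ?_ ?_ ?_ ?_ hf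
  · intro n
    simpa [mFourier_apply_zero] using exists_norm_mFourier_sub_one_le n
  · exact ⟨0, le_rfl, by simp⟩
  · rintro f g ⟨C, hC, h⟩ ⟨C', hC', h'⟩
    refine ⟨C + C', by positivity, fun α => ?_⟩
    have : (f + g) α - (f + g) 0 = (f α - f 0) + (g α - g 0) := by
      simp only [ContinuousMap.add_apply]
      ring
    rw [this, add_mul]
    exact (norm_add_le _ _).trans (add_le_add (h α) (h' α))
  · rintro r f ⟨C, hC, h⟩
    refine ⟨|r| * C, by positivity, fun α => ?_⟩
    have : (r • f) α - (r • f) 0 = r • (f α - f 0) := by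
      simp only [ContinuousMap.smul_apply, smul_sub]
    rw [this, norm_smul, mul_assoc, Real.norm_eq_abs]
    gcongr
    exact h α

/-- The real part of a real trigonometric polynomial is a cosine polynomial, so it is stationary
at the origin. -/
lemma exists_abs_re_sub_re_apply_zero_le {d : ℕ} {f : C(UnitAddTorus (Fin d), ℂ)}
    (hf : f ∈ realTrigPoly d) :
    ∃ C : ℝ, 0 ≤ C ∧ ∀ α, |(f α).re - (f 0).re| ≤ C * ‖α‖ ^ 2 := by
  refine realTrigPoly_induction ?_ ?_ ?_ ?_ hf
  · intro n
    obtain ⟨C, hC, h⟩ := exists_norm_mFourier_sub_one_le n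
    refine ⟨C ^ 2, by positivity, fun α => ?_⟩
    have h1 := h α
    have h2 : ‖mFourier n α - 1‖ ^ 2 ≤ (C * ‖α‖) ^ 2 := by gcongr
    have h3 : ‖mFourier n α‖ ^ 2 = 1 := by rw [norm_mFourier_apply, one_pow]
    rw [← Complex.normSq_eq_norm_sq, Complex.normSq_apply] at h2 h3
    rw [mFourier_apply_zero]
    simp only [Complex.sub_re, Complex.sub_im, Complex.one_re, Complex.one_im] at h2 ⊢
    rw [abs_le]
    constructor <;> nlinarith [sq_nonneg (mFourier n α).im, sq_nonneg ((mFourier n α).re - 1)]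
  · exact ⟨0, le_rfl, by simp⟩
  · rintro f g ⟨C, hC, h⟩ ⟨C', hC', h'⟩
    refine ⟨C + C', by positivity, fun α => ?_⟩
    have : ((f + g) α).re - ((f + g) 0).re = ((f α).re - (f 0).re) + ((g α).re - (g 0).re) := by
      simp only [ContinuousMap.add_apply, Complex.add_re]
      ring
    rw [this, add_mul]
    exact (abs_add_le _ _).trans (add_le_add (h α) (h' α))
  · rintro r f ⟨C, hC, h⟩
    refine ⟨|r| * C, by positivity, fun α => ?_⟩
    have : ((r • f) α).re - ((r • f) 0).re = r * ((f α).re - (f 0).re) := by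
      simp [mul_sub]
    rw [this, abs_mul, mul_assoc]
    gcongr
    exact h α

lemma norm_mFourier_one_sub_one (α : UnitAddTorus (Fin 1)) :
    4 * ‖α‖ ≤ ‖mFourier (1 : Fin 1 → ℤ) α - 1‖ ∧
      ‖mFourier (1 : Fin 1 → ℤ) α - 1‖ ≤ 2 * Real.pi * ‖α‖ := by
  have h1 : mFourier (1 : Fin 1 → ℤ) α = fourier 1 (α 0) := by
    simp [mFourier]
  have h2 : ‖α‖ = ‖α 0‖ := by
    refine le_antisymm ((pi_norm_le_iff_of_nonneg (norm_nonneg _)).2 fun i => ?_)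
      (norm_le_pi_norm α 0)
    rw [Subsingleton.elim i 0]
  rw [h1, h2]
  exact norm_fourier_one_sub_one _

lemma mFourier_natCast (n : ℕ) : mFourier (n : Fin 1 → ℤ) = mFourier 1 ^ n := by
  induction n with
  | zero => simp [mFourier_zero]
  | succ n ih =>
    rw [pow_succ, ← ih]
    ext α
    rw [Nat.cast_succ, mFourier_add]
    rfl

lemma mFourier_neg_natCast (n : ℕ) : mFourier (-(n : Fin 1 → ℤ)) = mFourier (-1) ^ n := by
  induction n with
  | zero => simp [mFourier_zero]
  | succ n ih =>
    rw [pow_succ, ← ih]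
    ext α
    rw [Nat.cast_succ, neg_add, mFourier_add]
    rfl

lemma exists_eq_natCast_or_neg (n : Fin 1 → ℤ) :
    ∃ m : ℕ, n = (m : Fin 1 → ℤ) ∨ n = -(m : Fin 1 → ℤ) := by
  obtain ⟨m, h⟩ := (n 0).eq_nat_or_neg
  refine ⟨m, h.imp (fun h => ?_) fun h => ?_⟩ <;>
  · funext i
    rw [Subsingleton.elim i 0, h]
    simp

lemma mFourier_one_mul_neg_one : mFourier (1 : Fin 1 → ℤ) * mFourier (-1) = 1 := by
  ext α
  have := mFourier_add (n := (-1 : Fin 1 → ℤ)) (m := 1) (x := α)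
  rw [add_neg_cancel, mFourier_zero] at this
  exact this.symm

/-- In one variable a real trigonometric polynomial vanishing at the origin is divisible by
`z - 1`, where `z` is the basic character. -/
lemma exists_eq_mul_of_apply_zero {f : C(UnitAddTorus (Fin 1), ℂ)} (hf : f ∈ realTrigPoly 1) :
    ∃ q ∈ realTrigPoly 1, ∀ α, f α - f 0 = (mFourier 1 α - 1) * q α := by
  refine realTrigPoly_induction ?_ ?_ ?_ ?_ hf
  · intro n
    obtain ⟨m, rfl | rfl⟩ := exists_eq_natCast_or_neg n
    · refine ⟨∑ i ∈ Finset.range m, mFourier 1 ^ i,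
        sum_mem fun i _ => pow_mem (mFourier_mem_realTrigPoly _) i, fun α => ?_⟩
      rw [mFourier_apply_zero, mFourier_natCast, mul_comm]
      simpa using (geom_sum_mul (mFourier (1 : Fin 1 → ℤ) α) m).symm
    · refine ⟨-(mFourier (-1) * ∑ i ∈ Finset.range m, mFourier (-1) ^ i),
        neg_mem (mul_mem (mFourier_mem_realTrigPoly _)
          (sum_mem fun i _ => pow_mem (mFourier_mem_realTrigPoly _) i)), fun α => ?_⟩
      rw [mFourier_apply_zero, mFourier_neg_natCast]
      have h1 : mFourier (1 : Fin 1 → ℤ) α * mFourier (-1) α = 1 :=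
        congrArg (fun f => f α) mFourier_one_mul_neg_one
      have h2 := geom_sum_mul (mFourier (-1 : Fin 1 → ℤ) α) m
      simp only [ContinuousMap.pow_apply, ContinuousMap.neg_apply, ContinuousMap.mul_apply,
        ContinuousMap.sum_apply]
      rw [← h2]
      linear_combination (∑ i ∈ Finset.range m, mFourier (-1 : Fin 1 → ℤ) α ^ i) * h1
  · exact ⟨0, zero_mem _, by simp⟩
  · rintro f g ⟨q, hq, h⟩ ⟨q', hq', h'⟩
    refine ⟨q + q', add_mem hq hq', fun α => ?_⟩
    simp only [ContinuousMap.add_apply]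
    linear_combination h α + h' α
  · rintro r f ⟨q, hq, h⟩
    refine ⟨r • q, Subalgebra.smul_mem _ hq r, fun α => ?_⟩
    simp only [ContinuousMap.smul_apply, Complex.real_smul]
    linear_combination r * h α

/-- In one variable the real part of a real trigonometric polynomial vanishing at the origin is
divisible by `|z - 1| ^ 2`, where `z` is the basic character. -/
lemma exists_re_eq_mul_of_apply_zero {f : C(UnitAddTorus (Fin 1), ℂ)} (hf : f ∈ realTrigPoly 1) :
    ∃ q ∈ realTrigPoly 1,
      ∀ α, (((f α).re - (f 0).re : ℝ) : ℂ) = (mFourier 1 α - 1) * (mFourier (-1) α - 1) * q α := by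
  refine realTrigPoly_induction ?_ ?_ ?_ ?_ hf
  · intro n
    have key : ∀ m : ℕ, ∀ α, (((mFourier (m : Fin 1 → ℤ) α).re - 1 : ℝ) : ℂ) =
        (mFourier 1 α - 1) * (mFourier (-1) α - 1) *
        ((-1 / 2 : ℝ) • ((∑ i ∈ Finset.range m, mFourier 1 ^ i) *
          ∑ i ∈ Finset.range m, mFourier (-1) ^ i) : C(UnitAddTorus (Fin 1), ℂ)) α := by
      intro m α
      have h1 := geom_sum_mul (mFourier (1 : Fin 1 → ℤ) α) m
      have h2 := geom_sum_mul (mFourier (-1 : Fin 1 → ℤ) α) m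
      have h3 : mFourier (1 : Fin 1 → ℤ) α * mFourier (-1) α = 1 :=
        congrArg (fun f => f α) mFourier_one_mul_neg_one
      have h4 : ((mFourier (m : Fin 1 → ℤ) α).re : ℂ) =
          (mFourier (1 : Fin 1 → ℤ) α ^ m + mFourier (-1 : Fin 1 → ℤ) α ^ m) / 2 := by
        rw [Complex.re_eq_add_conj, ← mFourier_neg, mFourier_neg_natCast, mFourier_natCast]
        rfl
      have h5 : mFourier (1 : Fin 1 → ℤ) α ^ m * mFourier (-1) α ^ m = 1 := by
        rw [← mul_pow, h3, one_pow]
      simp only [ContinuousMap.smul_apply, ContinuousMap.pow_apply, ContinuousMap.mul_apply,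
        ContinuousMap.sum_apply, Complex.real_smul, Complex.ofReal_sub, h4]
      push_cast
      set a := ∑ i ∈ Finset.range m, mFourier (1 : Fin 1 → ℤ) α ^ i
      set b := ∑ i ∈ Finset.range m, mFourier (-1 : Fin 1 → ℤ) α ^ i
      have h6 := congrArg₂ (· * ·) h1 h2
      linear_combination (1 / 2 : ℂ) * h6 + (1 / 2 : ℂ) * h5
    have mem : ∀ m : ℕ, ((-1 / 2 : ℝ) • ((∑ i ∈ Finset.range m, mFourier 1 ^ i) *
          ∑ i ∈ Finset.range m, mFourier (-1) ^ i) : C(UnitAddTorus (Fin 1), ℂ)) ∈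
          realTrigPoly 1 := fun m =>
      Subalgebra.smul_mem _ (mul_mem
        (sum_mem fun i _ => pow_mem (mFourier_mem_realTrigPoly _) i)
        (sum_mem fun i _ => pow_mem (mFourier_mem_realTrigPoly _) i)) _
    obtain ⟨m, rfl | rfl⟩ := exists_eq_natCast_or_neg n
    · refine ⟨_, mem m, fun α => ?_⟩
      rw [← key m α, mFourier_apply_zero, Complex.one_re]
    · refine ⟨_, mem m, fun α => ?_⟩
      rw [← key m α, mFourier_apply_zero, mFourier_neg, Complex.conj_re, Complex.one_re]
  · exact ⟨0, zero_mem _, by simp⟩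
  · rintro f g ⟨q, hq, h⟩ ⟨q', hq', h'⟩
    refine ⟨q + q', add_mem hq hq', fun α => ?_⟩
    have h1 := h α
    have h2 := h' α
    simp only [ContinuousMap.add_apply, Complex.add_re]
    push_cast at h1 h2 ⊢
    linear_combination h1 + h2
  · rintro r f ⟨q, hq, h⟩
    refine ⟨r • q, Subalgebra.smul_mem _ hq r, fun α => ?_⟩
    have h1 := h α
    simp only [ContinuousMap.smul_apply, Complex.real_smul, Complex.re_ofReal_mul]
    push_cast at h1 ⊢
    linear_combination r * h1

/-! ### Haar measure on the torus -/

instance torusHaar_isProbabilityMeasure (d : ℕ) : IsProbabilityMeasure (torusHaar d) := by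
  unfold torusHaar
  infer_instance

instance torusHaar_isAddHaarMeasure (d : ℕ) : (torusHaar d).IsAddHaarMeasure := by
  unfold torusHaar
  infer_instance

instance torusHaar_isNegInvariant (d : ℕ) : (torusHaar d).IsNegInvariant where
  neg_eq_self := by
    have h : (Measure.map (fun x => -x) (torusHaar d)).IsAddHaarMeasure :=
      (AddEquiv.neg (UnitAddTorus (Fin d))).isAddHaarMeasure_map _ continuous_neg continuous_neg
    have : IsProbabilityMeasure (Measure.map (fun x => -x) (torusHaar d)) :=
      Measure.isProbabilityMeasure_map (by fun_prop)
    change Measure.map (fun x => -x) (torusHaar d) = torusHaar d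
    exact Measure.isAddHaarMeasure_eq_of_isProbabilityMeasure _ _

lemma haarAddCircle_eq_volume :
    (AddCircle.haarAddCircle : Measure UnitAddCircle) = volume := by
  rw [AddCircle.volume_eq_smul_haarAddCircle]
  simp

instance haarAddCircle_nullSingletonClass :
    NullSingletonClass (AddCircle.haarAddCircle : Measure UnitAddCircle) := by
  rw [haarAddCircle_eq_volume]
  refine ⟨fun x => ?_⟩
  have := AddCircle.volume_closedBall 1 (x := x) 0
  simpa using this

lemma ae_coord_ne_zero (d : ℕ) : ∀ᵐ α ∂torusHaar d, ∀ i, α i ≠ 0 := by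
  rw [ae_all_iff]
  intro i
  exact Measure.ae_eval_ne (μ := fun _ : Fin d => AddCircle.haarAddCircle) i 0

lemma ae_ne_zero {d : ℕ} (hd : 1 ≤ d) : ∀ᵐ α ∂torusHaar d, α ≠ 0 := by
  filter_upwards [ae_coord_ne_zero d] with α hα h
  exact hα ⟨0, hd⟩ (by rw [h]; rfl)

lemma integral_mFourier {d : ℕ} (n : Fin d → ℤ) :
    ∫ α, mFourier n α ∂torusHaar d = if n = 0 then 1 else 0 := by
  have h1 : ∀ m : ℤ, ∫ t : UnitAddCircle, (fourier m t : ℂ) ∂AddCircle.haarAddCircle =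
      if m = 0 then 1 else 0 := by
    intro m
    have := congrFun (fourierCoeff_fourier (T := 1) m) 0
    simpa [fourierCoeff, Pi.single_apply, eq_comm] using this
  simp only [mFourier, ContinuousMap.coe_mk, torusHaar]
  rw [integral_fintype_prod_eq_prod]
  simp only [h1]
  split_ifs with h
  · simp [h]
  · obtain ⟨i, hi⟩ := Function.ne_iff.1 h
    exact Finset.prod_eq_zero (Finset.mem_univ i) (if_neg hi)

lemma integrable_norm_rpow_neg_unitAddCircle {s : ℝ} (hs : s < 1) :
    Integrable (fun t : UnitAddCircle => ‖t‖ ^ (-s)) AddCircle.haarAddCircle := by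
  rw [haarAddCircle_eq_volume, ← (UnitAddCircle.measurePreserving_mk (-1 / 2)).map_eq,
    integrable_map_measure (measurable_norm.pow_const _).aestronglyMeasurable (by fun_prop)]
  have h1 : IntervalIntegrable (fun x : ℝ => |x| ^ (-s)) volume (-1 / 2) (-1 / 2 + 1) := by
    have h0 : IntervalIntegrable (fun x : ℝ => x ^ (-s)) volume 0 (1 / 2) :=
      intervalIntegral.intervalIntegrable_rpow' (by linarith)
    have hp : IntervalIntegrable (fun x : ℝ => |x| ^ (-s)) volume 0 (1 / 2) := by
      refine h0.congr fun x hx => ?_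
      rw [Set.uIoc_of_le (by norm_num)] at hx
      rw [abs_of_pos hx.1]
    have hn : IntervalIntegrable (fun x : ℝ => |x| ^ (-s)) volume (-1 / 2) 0 := by
      have := (IntervalIntegrable.iff_comp_neg (by finiteness)).1 hp
      simp only [abs_neg] at this
      refine IntervalIntegrable.symm ?_
      convert this using 1 <;> norm_num
    convert hn.trans hp using 1
    norm_num
  rw [intervalIntegrable_iff_integrableOn_Ioc_of_le (by norm_num)] at h1
  refine h1.congr_fun (fun x hx => ?_) measurableSet_Ioc
  have : ‖(x : UnitAddCircle)‖ = |x| := by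
    refine (AddCircle.norm_coe_eq_abs_iff 1 one_ne_zero).2 ?_
    rw [abs_le]
    constructor <;> norm_num <;> linarith [hx.1, hx.2]
  exact congrArg (fun y : ℝ => y ^ (-s)) this.symm

/-- The singularity `‖α‖ ^ (-s)` is dominated by the product of the one-variable singularities
`‖α i‖ ^ (-s / d)`. -/
lemma integrable_norm_rpow_neg {d : ℕ} {s : ℝ} (hs0 : 0 ≤ s) (hs : s < d) :
    Integrable (fun α : UnitAddTorus (Fin d) => ‖α‖ ^ (-s)) (torusHaar d) := by
  have hd : (0 : ℝ) < d := hs0.trans_lt hs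
  have h1 : Integrable (fun α : UnitAddTorus (Fin d) => ∏ i, ‖α i‖ ^ (-(s / d)))
      (torusHaar d) :=
    Integrable.fintype_prod fun i =>
      integrable_norm_rpow_neg_unitAddCircle ((div_lt_one hd).2 hs)
  refine h1.mono' (measurable_norm.pow_const _).aestronglyMeasurable ?_
  filter_upwards [ae_coord_ne_zero d] with α hα
  rw [Real.norm_of_nonneg (by positivity)]
  have h2 : ‖α‖ ^ (-s) = ∏ _i : Fin d, ‖α‖ ^ (-(s / d)) := by
    rw [Finset.prod_const, Finset.card_univ, Fintype.card_fin, ← Real.rpow_natCast,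
      ← Real.rpow_mul (norm_nonneg _)]
    congr 1
    field_simp
  rw [h2]
  refine Finset.prod_le_prod (fun i _ => by positivity) fun i _ => ?_
  exact Real.rpow_le_rpow_of_nonpos (norm_pos_iff.2 (hα i)) (norm_le_pi_norm α i)
    (by rw [neg_nonpos]; positivity)

/-! ### Fourier integrals of quotients of trigonometric polynomials -/

lemma integrable_div_of_abs_le {d : ℕ} (hd : 1 ≤ d) {f p : UnitAddTorus (Fin d) → ℝ}
    (hf : Continuous f) (hp : Continuous p) {c C : ℝ} (hc : 0 < c)
    (hlow : ∀ α, c * ‖α‖ ^ 2 ≤ p α) {m : ℕ} (hm : m ≤ 2) (hmd : 2 < d + m)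
    (hup : ∀ α, |f α| ≤ C * ‖α‖ ^ m) :
    Integrable (fun α => f α / p α) (torusHaar d) := by
  have hm' : (m : ℝ) ≤ 2 := by exact_mod_cast hm
  have hmd' : (2 : ℝ) < d + m := by exact_mod_cast hmd
  have h1 := (integrable_norm_rpow_neg (d := d) (s := 2 - m) (by linarith)
    (by linarith)).const_mul (C / c)
  refine h1.mono' (hf.measurable.div hp.measurable).aestronglyMeasurable ?_
  filter_upwards [ae_ne_zero hd] with α hα
  have hpos : 0 < ‖α‖ := norm_pos_iff.2 hα
  have hpp : 0 < p α := lt_of_lt_of_le (by positivity) (hlow α)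
  have h2 : ‖α‖ ^ (-(2 - m : ℝ)) = ‖α‖ ^ m / ‖α‖ ^ 2 := by
    rw [neg_sub, Real.rpow_sub hpos]
    norm_cast
  rw [h2, Real.norm_eq_abs, abs_div, abs_of_pos hpp, div_mul_div_comm]
  exact div_le_div₀ ((abs_nonneg _).trans (hup α)) (hup α) (by positivity) (hlow α)

lemma abs_integral_re_mul_mFourier_div_le {d : ℕ} {F : C(UnitAddTorus (Fin d), ℂ)}
    {p : UnitAddTorus (Fin d) → ℝ} (hp : ∀ α, 0 ≤ p α)
    (hF : Integrable (fun α => ‖F α‖ / p α) (torusHaar d)) (x : Fin d → ℤ) :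
    |∫ α, (F α * mFourier x α).re / p α ∂torusHaar d| ≤ ∫ α, ‖F α‖ / p α ∂torusHaar d := by
  rw [← Real.norm_eq_abs]
  refine norm_integral_le_of_norm_le hF (Filter.Eventually.of_forall fun α => ?_)
  rw [Real.norm_eq_abs, abs_div, abs_of_nonneg (hp α)]
  refine div_le_div_of_nonneg_right ((Complex.abs_re_le_norm _).trans ?_) (hp α)
  rw [norm_mul, norm_mFourier_apply, mul_one]

/-- The geometric sum `(z ^ x - 1) / (z⁻¹ - 1)`, whose mean over the circle is `0` for `0 ≤ x`
and `1` for `x < 0`. -/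
lemma exists_mFourier_eq_one_add_mul (x : Fin 1 → ℤ) :
    ∃ T : C(UnitAddTorus (Fin 1), ℂ),
      (∀ α, mFourier x α = 1 + (mFourier (-1) α - 1) * T α) ∧
      ‖∫ α, T α ∂torusHaar 1‖ ≤ 1 := by
  obtain ⟨m, rfl | rfl⟩ := exists_eq_natCast_or_neg x
  · refine ⟨-∑ i ∈ Finset.range m, mFourier ((i + 1 : ℕ) : Fin 1 → ℤ), fun α => ?_, ?_⟩
    · have h1 := geom_sum_mul (mFourier (1 : Fin 1 → ℤ) α) m
      have h3 : mFourier (1 : Fin 1 → ℤ) α * mFourier (-1) α = 1 :=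
        congrArg (fun f => f α) mFourier_one_mul_neg_one
      simp only [mFourier_natCast, ContinuousMap.neg_apply, ContinuousMap.sum_apply,
        ContinuousMap.pow_apply, pow_succ, ContinuousMap.mul_apply, ← Finset.sum_mul]
      linear_combination (-1 : ℂ) * h1 +
        (∑ i ∈ Finset.range m, mFourier (1 : Fin 1 → ℤ) α ^ i) * h3
    · simp only [ContinuousMap.neg_apply, ContinuousMap.sum_apply]
      rw [integral_neg, integral_finsetSum _ fun i _ =>
        (mFourier _).continuous.integrable_of_hasCompactSupport
          (HasCompactSupport.of_compactSpace _)]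
      simp only [integral_mFourier]
      rw [Finset.sum_eq_zero fun i _ => if_neg fun h => ?_]
      · simp
      · have := congrFun h 0
        simp at this
        omega
  · refine ⟨∑ i ∈ Finset.range m, mFourier (-(i : Fin 1 → ℤ)), fun α => ?_, ?_⟩
    · have h1 := geom_sum_mul (mFourier (-1 : Fin 1 → ℤ) α) m
      simp only [mFourier_neg_natCast, ContinuousMap.sum_apply, ContinuousMap.pow_apply]
      linear_combination (-1 : ℂ) * h1
    · simp only [ContinuousMap.sum_apply]
      rw [integral_finsetSum _ fun i _ =>
        (mFourier _).continuous.integrable_of_hasCompactSupport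
          (HasCompactSupport.of_compactSpace _)]
      simp only [integral_mFourier]
      have h0 : ∀ i : ℕ, (-(i : Fin 1 → ℤ) = 0) ↔ i = 0 := by
        intro i
        rw [neg_eq_zero]
        exact ⟨fun h => by simpa using congrFun h 0, fun h => by simp [h]⟩
      simp only [h0, Finset.sum_ite_eq']
      split_ifs <;> simp

lemma re_inv_sub_one {w : ℂ} (hw : ‖w‖ = 1) (hw1 : w ≠ 1) : ((w - 1)⁻¹).re = -1 / 2 := by
  have h1 : Complex.normSq (w - 1) ≠ 0 := by
    rwa [Ne, Complex.normSq_eq_zero, sub_eq_zero]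
  have h2 : ‖w‖ ^ 2 = 1 := by rw [hw, one_pow]
  rw [← Complex.normSq_eq_norm_sq, Complex.normSq_apply] at h2
  rw [Complex.inv_re, div_eq_iff h1, Complex.normSq_apply]
  simp
  nlinarith

/-- In one variable, with `z` the basic character, the quotient `F / P` is a real multiple of
`(z⁻¹ - 1)⁻¹` up to a bounded function, and the Fourier integrals of `(z⁻¹ - 1)⁻¹` reduce to
geometric sums. -/
lemma exists_abs_integral_le_of_circle {F P : C(UnitAddTorus (Fin 1), ℂ)}
    (hF : F ∈ realTrigPoly 1) (hF0 : F 0 = 0) (hP : P ∈ realTrigPoly 1) (hP0 : P 0 = 0)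
    (hPim : ∀ α, (P α).im = 0) {c : ℝ} (hc : 0 < c) (hlow : ∀ α, c * ‖α‖ ^ 2 ≤ (P α).re) :
    ∃ C : ℝ, ∀ x, |∫ α, (F α * mFourier x α).re / (P α).re ∂torusHaar 1| ≤ C := by
  obtain ⟨F₁, hF₁, hFF₁⟩ := exists_eq_mul_of_apply_zero hF
  obtain ⟨P₁, hP₁, hPP₁⟩ := exists_re_eq_mul_of_apply_zero hP
  have hPre : ∀ α, P α = ((P α).re : ℂ) := fun α => Complex.ext rfl (by simp [hPim])
  rw [hF0] at hFF₁
  simp only [hP0, Complex.zero_re, sub_zero] at hFF₁ hPP₁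
  have hconj : ∀ α, mFourier (-1 : Fin 1 → ℤ) α - 1 = conj (mFourier 1 α - 1) := by
    intro α
    rw [mFourier_neg, map_sub, map_one]
  have hz : ∀ α ≠ (0 : UnitAddTorus (Fin 1)), mFourier (1 : Fin 1 → ℤ) α - 1 ≠ 0 := by
    intro α hα
    refine norm_pos_iff.1 (lt_of_lt_of_le ?_ (norm_mFourier_one_sub_one α).1)
    have := norm_pos_iff.2 hα
    positivity
  set c' : ℝ := c / (2 * Real.pi) ^ 2 with hc'
  have hc'pos : 0 < c' := by positivity
  have hP₁low : ∀ α ≠ 0, c' ≤ ‖P₁ α‖ := by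
    intro α hα
    have h1 := congrArg norm (hPP₁ α)
    rw [hconj, norm_mul, norm_mul, RCLike.norm_conj, Complex.norm_real, Real.norm_eq_abs] at h1
    have h2 := (hlow α).trans (le_abs_self _)
    have h3 := (norm_mFourier_one_sub_one α).2
    have h4 : 0 < ‖α‖ := norm_pos_iff.2 hα
    rw [h1] at h2
    have h5 : ‖mFourier (1 : Fin 1 → ℤ) α - 1‖ * ‖mFourier (1 : Fin 1 → ℤ) α - 1‖ * ‖P₁ α‖ ≤
        (2 * Real.pi * ‖α‖) * (2 * Real.pi * ‖α‖) * ‖P₁ α‖ := by gcongr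
    rw [hc', div_le_iff₀ (by positivity)]
    have h6 := h2.trans h5
    have h7 : c * ‖α‖ ^ 2 ≤ ‖P₁ α‖ * (2 * Real.pi) ^ 2 * ‖α‖ ^ 2 := by linarith
    exact le_of_mul_le_mul_right h7 (by positivity)
  have hP₁0 : c' ≤ ‖P₁ 0‖ := by
    have hd : Dense {α : UnitAddTorus (Fin 1) | α ≠ 0} :=
      Measure.dense_of_ae (ae_ne_zero le_rfl)
    have hcl : IsClosed {α : UnitAddTorus (Fin 1) | c' ≤ ‖P₁ α‖} :=
      isClosed_le continuous_const P₁.continuous.norm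
    exact hcl.closure_subset_iff.2 (fun α hα => hP₁low α hα) (hd 0)
  -- the residue of `F / P` at the origin
  set r : ℝ := (F₁ 0).re / (P₁ 0).re with hr
  have hG : F₁ - r • P₁ ∈ realTrigPoly 1 := sub_mem hF₁ (Subalgebra.smul_mem _ hP₁ r)
  have hG0 : (F₁ - r • P₁) 0 = 0 := by
    have h1 : F₁ 0 = ((F₁ 0).re : ℂ) :=
      Complex.ext rfl (by simp [realTrigPoly_im_apply_zero hF₁])
    have h2 : P₁ 0 = ((P₁ 0).re : ℂ) :=
      Complex.ext rfl (by simp [realTrigPoly_im_apply_zero hP₁])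
    have h3 : (P₁ 0).re ≠ 0 := by
      intro h
      rw [h2, h] at hP₁0
      simp at hP₁0
      linarith
    simp only [ContinuousMap.sub_apply, ContinuousMap.smul_apply, Complex.real_smul]
    rw [h1, h2, ← Complex.ofReal_mul, ← Complex.ofReal_sub, hr]
    simp [h3]
  obtain ⟨F₂, -, hGF₂⟩ := exists_eq_mul_of_apply_zero hG
  simp only [hG0, sub_zero, ContinuousMap.sub_apply, ContinuousMap.smul_apply,
    Complex.real_smul] at hGF₂
  refine ⟨|r| / 2 + ‖F₂‖ / c' + |r|, fun x => ?_⟩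
  obtain ⟨T, hT, hTint⟩ := exists_mFourier_eq_one_add_mul x
  have hTi : Integrable (fun α => T α) (torusHaar 1) :=
    T.continuous.integrable_of_hasCompactSupport (HasCompactSupport.of_compactSpace _)
  have hint : Integrable (fun α => (F α * mFourier x α).re / (P α).re) (torusHaar 1) := by
    obtain ⟨K, -, hK⟩ := exists_abs_re_sub_re_apply_zero_le
      (mul_mem hF (mFourier_mem_realTrigPoly x))
    refine integrable_div_of_abs_le (m := 2) (C := K) le_rfl (by fun_prop) (by fun_prop) hc hlow
      le_rfl (by norm_num) fun α => ?_
    simpa [hF0] using hK α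
  have hsplit : ∫ α, (F α * mFourier x α).re / (P α).re ∂torusHaar 1 =
      ∫ α, ((F α * mFourier x α).re / (P α).re - r * (T α).re) ∂torusHaar 1 +
        r * (∫ α, T α ∂torusHaar 1).re := by
    have h1 : (∫ α, T α ∂torusHaar 1).re = ∫ α, (T α).re ∂torusHaar 1 :=
      (integral_re hTi).symm
    have hTr : Integrable (fun α => r * (T α).re) (torusHaar 1) := hTi.re.const_mul r
    rw [h1, ← integral_const_mul, integral_sub hint hTr, sub_add_cancel]
  rw [hsplit]
  refine (abs_add_le _ _).trans (add_le_add ?_ ?_)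
  · have hb : ∀ᵐ α ∂torusHaar 1,
        ‖(F α * mFourier x α).re / (P α).re - r * (T α).re‖ ≤ |r| / 2 + ‖F₂‖ / c' := by
      filter_upwards [ae_ne_zero le_rfl] with α hα
      have hz1 := hz α hα
      have hw1 : mFourier (-1 : Fin 1 → ℤ) α - 1 ≠ 0 := by
        rw [hconj]
        exact (map_ne_zero _).2 hz1
      have hp1 : P₁ α ≠ 0 := norm_pos_iff.1 (hc'pos.trans_le (hP₁low α hα))
      have hquot : F α * mFourier x α / P α = r * T α + r * (mFourier (-1) α - 1)⁻¹ +
          (mFourier 1 α - 1) * F₂ α * mFourier x α / ((mFourier (-1) α - 1) * P₁ α) := by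
        have h1 : F₁ α = r * P₁ α + (mFourier 1 α - 1) * F₂ α := by
          linear_combination hGF₂ α
        rw [hPre α, hPP₁ α, hFF₁ α, h1]
        have hx := hT α
        field_simp
        linear_combination (r * P₁ α) * hx
      have hre : (F α * mFourier x α).re / (P α).re = (F α * mFourier x α / P α).re := by
        rw [hPre α, Complex.div_ofReal_re, Complex.ofReal_re]
      rw [hre, hquot, Complex.add_re, Complex.add_re, Complex.re_ofReal_mul,
        Complex.re_ofReal_mul, re_inv_sub_one (norm_mFourier_apply _ _) (sub_ne_zero.1 hw1)]
      have h2 : ‖(mFourier 1 α - 1) * F₂ α * mFourier x α / ((mFourier (-1) α - 1) * P₁ α)‖ ≤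
          ‖F₂‖ / c' := by
        rw [norm_div, norm_mul, norm_mul, norm_mul, norm_mFourier_apply, hconj,
          RCLike.norm_conj, mul_one, mul_div_mul_left _ _ (norm_ne_zero_iff.2 hz1)]
        exact div_le_div₀ (norm_nonneg _) (F₂.norm_coe_le_norm α) hc'pos (hP₁low α hα)
      have h3 := (Complex.abs_re_le_norm _).trans h2
      rw [Real.norm_eq_abs]
      set B := ((mFourier 1 α - 1) * F₂ α * mFourier x α / ((mFourier (-1) α - 1) * P₁ α)).re
      have h4 : r * (T α).re + r * (-1 / 2) + B - r * (T α).re = -(r / 2) + B := by ring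
      rw [h4]
      refine (abs_add_le _ _).trans (add_le_add ?_ h3)
      rw [abs_neg, abs_div, abs_two]
    simpa using norm_integral_le_of_norm_le_const hb
  · rw [abs_mul]
    exact mul_le_of_le_one_right (abs_nonneg r) ((Complex.abs_re_le_norm _).trans hTint)

/-- Fourier integrals of `F / P` are bounded as soon as the first of them exists. If `F 0 ≠ 0`
then integrability of `Re F / P` forces that of `1 / P`; if `F 0 = 0` then `F / P` has a
singularity of order one, which is integrable unless the torus is a circle. -/
lemma exists_abs_integral_le_of_real {d : ℕ} (hd : 1 ≤ d) {F P : C(UnitAddTorus (Fin d), ℂ)}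
    (hF : F ∈ realTrigPoly d) (hP : P ∈ realTrigPoly d) (hP0 : P 0 = 0)
    (hPim : ∀ α, (P α).im = 0) {c : ℝ} (hc : 0 < c) (hlow : ∀ α, c * ‖α‖ ^ 2 ≤ (P α).re)
    (hint : Integrable (fun α => (F α).re / (P α).re) (torusHaar d)) :
    ∃ C : ℝ, ∀ x, |∫ α, (F α * mFourier x α).re / (P α).re ∂torusHaar d| ≤ C := by
  have hPnonneg : ∀ α, 0 ≤ (P α).re := fun α => le_trans (by positivity) (hlow α)
  have hmeas : AEStronglyMeasurable (fun α => ‖F α‖ / (P α).re) (torusHaar d) :=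
    (Measurable.div (by fun_prop) (by fun_prop)).aestronglyMeasurable
  by_cases hF0 : F 0 = 0
  -- on a circle `F / P` itself need not be integrable
  · obtain rfl | hd2 := hd.eq_or_lt
    · exact exists_abs_integral_le_of_circle hF hF0 hP hP0 hPim hc hlow
    · obtain ⟨K, -, hK⟩ := exists_norm_sub_apply_zero_le hF
      refine ⟨_, abs_integral_re_mul_mFourier_div_le hPnonneg ?_⟩
      refine integrable_div_of_abs_le (m := 1) (C := K) hd (by fun_prop) (by fun_prop) hc hlow
        (by norm_num) (by omega) fun α => ?_
      simpa [hF0] using hK α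
  · refine ⟨_, abs_integral_re_mul_mFourier_div_le hPnonneg ?_⟩
    have ha : (F 0).re ≠ 0 := fun h =>
      hF0 (Complex.ext h (realTrigPoly_im_apply_zero hF))
    obtain ⟨K, hK0, hK⟩ := exists_abs_re_sub_re_apply_zero_le hF
    -- `|Re F(0)| ≤ |Re F| + K ‖α‖ ^ 2` and `K ‖α‖ ^ 2 / P ≤ K / c`
    have hdom := (hint.norm.add (integrable_const (K / c))).const_mul (‖F‖ / |(F 0).re|)
    refine hdom.mono' hmeas ?_
    filter_upwards [ae_ne_zero hd] with α hα
    have hpos : 0 < ‖α‖ := norm_pos_iff.2 hα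
    have hp : 0 < (P α).re := lt_of_lt_of_le (by positivity) (hlow α)
    rw [Real.norm_of_nonneg (by positivity)]
    have h1 : |(F 0).re| / (P α).re ≤ ‖(F α).re / (P α).re‖ + K / c := by
      rw [Real.norm_eq_abs, abs_div, abs_of_pos hp]
      have h2 : |(F 0).re| ≤ |(F α).re| + K * ‖α‖ ^ 2 := by
        have h3 := hK α
        rw [abs_sub_comm] at h3
        have h4 := abs_sub_abs_le_abs_sub (F 0).re (F α).re
        linarith
      have h5 : K * ‖α‖ ^ 2 / (P α).re ≤ K / c := by
        rw [div_le_div_iff₀ hp hc]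
        have := mul_le_mul_of_nonneg_left (hlow α) hK0
        linarith
      calc |(F 0).re| / (P α).re ≤ (|(F α).re| + K * ‖α‖ ^ 2) / (P α).re := by gcongr
        _ ≤ _ := by rw [add_div]; gcongr
    calc ‖F α‖ / (P α).re ≤ ‖F‖ / (P α).re := by
          gcongr
          exact F.norm_coe_le_norm α
      _ = ‖F‖ / |(F 0).re| * (|(F 0).re| / (P α).re) := by
          have := abs_pos.2 ha
          field_simp
      _ ≤ _ := by
          gcongr
          exact h1

/-- The part of the integrand coming from the imaginary coefficients is odd, so that it
contributes nothing to the integral, and integrability passes to the even part. -/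
lemma exists_abs_integral_le {d : ℕ} (hd : 1 ≤ d) {F F' P : C(UnitAddTorus (Fin d), ℂ)}
    (hF : F ∈ realTrigPoly d) (hF' : F' ∈ realTrigPoly d) (hP : P ∈ realTrigPoly d)
    (hP0 : P 0 = 0) (hPim : ∀ α, (P α).im = 0) {c : ℝ} (hc : 0 < c)
    (hlow : ∀ α, c * ‖α‖ ^ 2 ≤ (P α).re)
    (hint : ∀ x, Integrable (fun α => ((F α + Complex.I * F' α) * mFourier x α).re / (P α).re)
      (torusHaar d)) :
    ∃ C : ℝ, ∀ x,
      |∫ α, ((F α + Complex.I * F' α) * mFourier x α).re / (P α).re ∂torusHaar d| ≤ C := by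
  have heven : ∀ x α, (((F α + Complex.I * F' α) * mFourier x α).re / (P α).re +
      ((F (-α) + Complex.I * F' (-α)) * mFourier x (-α)).re / (P (-α)).re) / 2 =
      (F α * mFourier x α).re / (P α).re := by
    intro x α
    rw [realTrigPoly_apply_neg hF, realTrigPoly_apply_neg hF', realTrigPoly_apply_neg hP,
      realTrigPoly_apply_neg (mFourier_mem_realTrigPoly x), Complex.conj_re, ← add_div,
      div_right_comm]
    congr 1
    simp
    ring
  have hint' : ∀ x, Integrable (fun α => (F α * mFourier x α).re / (P α).re) (torusHaar d) := by
    intro x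
    have := ((hint x).add (hint x).comp_neg).div_const 2
    refine this.congr (Filter.Eventually.of_forall fun α => ?_)
    exact heven x α
  have hintegral : ∀ x,
      ∫ α, ((F α + Complex.I * F' α) * mFourier x α).re / (P α).re ∂torusHaar d =
      ∫ α, (F α * mFourier x α).re / (P α).re ∂torusHaar d := by
    intro x
    simp only [← heven x]
    rw [integral_div, integral_add (hint x) (hint x).comp_neg,
      integral_neg_eq_self (fun α => ((F α + Complex.I * F' α) * mFourier x α).re / (P α).re)]
    ring
  simp only [hintegral]
  refine exists_abs_integral_le_of_real hd hF hP hP0 hPim hc hlow ?_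
  simpa [mFourier_zero] using hint' 0

/-! ### The quadratic form of `1 - Q(α)` -/

variable {d k : ℕ} (G : PeriodicLattice d k)

lemma mult_add (x z : Fin d → ℤ) (i j : Fin k) :
    G.mult (x, i) (x + z, j) = G.mult (0, i) (z, j) := by
  rw [G.periodic, add_sub_cancel_left]

lemma mult_neg (z : Fin d → ℤ) (i j : Fin k) :
    G.mult (0, i) (-z, j) = G.mult (0, j) (z, i) := by
  rw [G.mult_symm, G.periodic, zero_sub, neg_neg]

lemma finite_edgeShifts : {z : Fin d → ℤ | ∃ i j, G.mult (0, i) (z, j) ≠ 0}.Finite := by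
  refine (Set.finite_iUnion fun i : Fin k => (G.locallyFinite (0, i)).image Prod.fst).subset ?_
  rintro z ⟨i, j, h⟩
  exact Set.mem_iUnion.2 ⟨i, (z, j), h, rfl⟩

/-- The finitely many translations by which an edge of the lattice can move. -/
noncomputable def edgeShifts : Finset (Fin d → ℤ) := G.finite_edgeShifts.toFinset

variable {G} in
lemma mem_edgeShifts {z : Fin d → ℤ} :
    z ∈ G.edgeShifts ↔ ∃ i j, G.mult (0, i) (z, j) ≠ 0 := by
  simp [edgeShifts]

lemma neg_mem_edgeShifts {z : Fin d → ℤ} (hz : z ∈ G.edgeShifts) : -z ∈ G.edgeShifts := by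
  obtain ⟨i, j, h⟩ := mem_edgeShifts.1 hz
  exact mem_edgeShifts.2 ⟨j, i, by rwa [mult_neg]⟩

lemma sum_edgeShifts_neg {M : Type*} [AddCommMonoid M] (f : (Fin d → ℤ) → M) :
    ∑ z ∈ G.edgeShifts, f (-z) = ∑ z ∈ G.edgeShifts, f z :=
  Finset.sum_nbij' (fun z => -z) (fun z => -z) (fun _ => G.neg_mem_edgeShifts)
    (fun _ => G.neg_mem_edgeShifts) (fun _ _ => neg_neg _) (fun _ _ => neg_neg _) fun _ _ => rfl

lemma finsum_eq_sum_edgeShifts {M : Type*} [AddCommMonoid M] (x : Fin d → ℤ) (i : Fin k)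
    (f : (Fin d → ℤ) × Fin k → M) (hf : ∀ q, G.mult (x, i) q = 0 → f q = 0) :
    ∑ᶠ q, f q = ∑ z ∈ G.edgeShifts, ∑ j, f (x + z, j) := by
  rw [← finsum_comp_equiv ((Equiv.addLeft x).prodCongr (Equiv.refl (Fin k))),
    finsum_eq_sum_of_support_subset (s := G.edgeShifts ×ˢ Finset.univ), Finset.sum_product]
  · rfl
  · rintro ⟨z, j⟩ hz
    rw [Finset.mem_coe, Finset.mem_product]
    refine ⟨mem_edgeShifts.2 ⟨i, j, fun h => hz ?_⟩, Finset.mem_univ _⟩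
    exact hf _ ((G.mult_add x z i j).trans h)

lemma sum_mult (i : Fin k) : ∑ z ∈ G.edgeShifts, ∑ j, G.mult (0, i) (z, j) = G.D := by
  rw [← G.regular (0, i), G.finsum_eq_sum_edgeShifts 0 i _ fun q h => h]
  simp

lemma sum_mult_left (j : Fin k) : ∑ z ∈ G.edgeShifts, ∑ i, G.mult (0, i) (z, j) = G.D := by
  rw [← G.sum_mult j, ← G.sum_edgeShifts_neg]
  simp only [mult_neg]

lemma degree_pos : 0 < G.D := by
  obtain ⟨⟨x, i⟩, h⟩ := G.exists_selfEdge
  have h0 := G.mult_add x 0 i i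
  rw [add_zero] at h0
  rw [h0] at h
  rw [← G.sum_mult i]
  refine Finset.sum_pos' (fun _ _ => Nat.zero_le _) ⟨0, mem_edgeShifts.2 ⟨i, i, h⟩, ?_⟩
  exact Finset.sum_pos' (fun _ _ => Nat.zero_le _) ⟨i, Finset.mem_univ _, Nat.pos_of_ne_zero h⟩

lemma nonempty_index (G : PeriodicLattice d k) : Nonempty (Fin k) := by
  obtain ⟨p, -⟩ := G.exists_selfEdge
  exact ⟨p.2⟩

lemma symbol_apply (α : UnitAddTorus (Fin d)) (i j : Fin k) :
    G.symbol α i j =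
      (G.D : ℂ)⁻¹ * ∑ z ∈ G.edgeShifts, mFourier z α * (G.mult (0, i) (z, j) : ℂ) := by
  unfold symbol adjMatrix character
  simp only [Matrix.of_apply]
  rw [finsum_eq_sum_of_support_subset]
  intro z hz
  refine mem_edgeShifts.2 ⟨i, j, fun h => hz ?_⟩
  simp [h]

lemma adjacencyOp_apply (f : (Fin d → ℤ) × Fin k → ℂ) (x : Fin d → ℤ) (i : Fin k) :
    G.adjacencyOp f (x, i) = (G.D : ℂ)⁻¹ *
      ∑ z ∈ G.edgeShifts, ∑ j, (G.mult (0, i) (z, j) : ℂ) * f (x + z, j) := by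
  unfold adjacencyOp
  rw [G.finsum_eq_sum_edgeShifts x i _ fun q h => by simp [h]]
  simp only [mult_add]

lemma isHermitian_symbol (α : UnitAddTorus (Fin d)) : (G.symbol α).IsHermitian := by
  refine Matrix.IsHermitian.ext fun i j => ?_
  rw [symbol_apply, symbol_apply, ← G.sum_edgeShifts_neg (fun z => mFourier z α *
    (G.mult (0, i) (z, j) : ℂ))]
  simp [mult_neg, mFourier_neg]

/-- The quadratic form of `1 - Q(α)`. -/
noncomputable def energy (α : UnitAddTorus (Fin d)) (f : Fin k → ℂ) : ℝ :=
  (star f ⬝ᵥ (1 - G.symbol α) *ᵥ f).re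

/-- The quadratic form of `1 - Q(α)` is a sum of squares over the edges. -/
lemma two_mul_degree_mul_energy (α : UnitAddTorus (Fin d)) (f : Fin k → ℂ) :
    2 * G.D * G.energy α f = ∑ z ∈ G.edgeShifts, ∑ i, ∑ j,
      (G.mult (0, i) (z, j) : ℝ) * ‖f i - mFourier z α * f j‖ ^ 2 := by
  have hD : (G.D : ℝ) ≠ 0 := by exact_mod_cast G.degree_pos.ne'
  have hexp : ∀ z i j, ‖f i - mFourier z α * f j‖ ^ 2 =
      ‖f i‖ ^ 2 + ‖f j‖ ^ 2 - 2 * (conj (f i) * (mFourier z α * f j)).re := by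
    intro z i j
    have h1 : ‖f j‖ ^ 2 = ‖mFourier z α * f j‖ ^ 2 := by
      rw [norm_mul, norm_mFourier_apply, one_mul]
    rw [h1]
    simp only [← Complex.normSq_eq_norm_sq, Complex.normSq_sub]
    have h2 : (f i * conj (mFourier z α * f j)).re = (conj (f i) * (mFourier z α * f j)).re := by
      rw [← Complex.conj_re, map_mul, Complex.conj_conj]
    rw [h2]
  have hleft : ∑ z ∈ G.edgeShifts, ∑ i, ∑ j, (G.mult (0, i) (z, j) : ℝ) * ‖f i‖ ^ 2 =
      G.D * ∑ i, ‖f i‖ ^ 2 := by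
    rw [Finset.sum_comm, Finset.mul_sum]
    refine Finset.sum_congr rfl fun i _ => ?_
    simp only [← Finset.sum_mul]
    rw [← G.sum_mult i]
    push_cast
    rfl
  have hright : ∑ z ∈ G.edgeShifts, ∑ i, ∑ j, (G.mult (0, i) (z, j) : ℝ) * ‖f j‖ ^ 2 =
      G.D * ∑ i, ‖f i‖ ^ 2 := by
    have : ∀ z ∈ G.edgeShifts, ∑ i, ∑ j, (G.mult (0, i) (z, j) : ℝ) * ‖f j‖ ^ 2 =
        ∑ j, ∑ i, (G.mult (0, i) (z, j) : ℝ) * ‖f j‖ ^ 2 := fun z _ => Finset.sum_comm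
    rw [Finset.sum_congr rfl this, Finset.sum_comm, Finset.mul_sum]
    refine Finset.sum_congr rfl fun j _ => ?_
    simp only [← Finset.sum_mul]
    rw [← G.sum_mult_left j]
    push_cast
    rfl
  have henergy : G.energy α f = ∑ i, ‖f i‖ ^ 2 - (G.D : ℝ)⁻¹ * ∑ z ∈ G.edgeShifts, ∑ i, ∑ j,
      (G.mult (0, i) (z, j) : ℝ) * (conj (f i) * (mFourier z α * f j)).re := by
    have h1 : star f ⬝ᵥ f = ((∑ i, ‖f i‖ ^ 2 : ℝ) : ℂ) := by
      simp only [dotProduct, Pi.star_apply, RCLike.star_def, Complex.conj_mul']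
      push_cast
      rfl
    have h2 : star f ⬝ᵥ G.symbol α *ᵥ f = (G.D : ℂ)⁻¹ * ∑ z ∈ G.edgeShifts, ∑ i, ∑ j,
        (G.mult (0, i) (z, j) : ℂ) * (conj (f i) * (mFourier z α * f j)) := by
      simp only [dotProduct, mulVec, symbol_apply, Finset.mul_sum, Finset.sum_mul,
        Pi.star_apply, RCLike.star_def]
      conv_rhs => rw [Finset.sum_comm]
      refine Finset.sum_congr rfl fun i _ => ?_
      rw [Finset.sum_comm]
      refine Finset.sum_congr rfl fun z _ => Finset.sum_congr rfl fun j _ => ?_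
      ring
    rw [energy, sub_mulVec, one_mulVec, dotProduct_sub, h1, h2, Complex.sub_re, Complex.ofReal_re,
      ← Complex.ofReal_natCast, ← Complex.ofReal_inv, Complex.re_ofReal_mul, Complex.re_sum]
    simp only [Complex.re_sum, ← Complex.ofReal_natCast, Complex.re_ofReal_mul]
  rw [henergy]
  simp only [hexp, mul_sub, mul_add, Finset.sum_sub_distrib, Finset.sum_add_distrib]
  rw [hleft, hright]
  have h3 : ∑ z ∈ G.edgeShifts, ∑ i, ∑ j,
      (G.mult (0, i) (z, j) : ℝ) * (2 * (conj (f i) * (mFourier z α * f j)).re) =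
      2 * ∑ z ∈ G.edgeShifts, ∑ i, ∑ j,
      (G.mult (0, i) (z, j) : ℝ) * (conj (f i) * (mFourier z α * f j)).re := by
    simp only [Finset.mul_sum]
    refine Finset.sum_congr rfl fun z _ => Finset.sum_congr rfl fun i _ =>
      Finset.sum_congr rfl fun j _ => ?_
    ring
  rw [h3]
  field_simp
  ring

lemma energy_nonneg (α : UnitAddTorus (Fin d)) (f : Fin k → ℂ) : 0 ≤ G.energy α f := by
  have hD : (0 : ℝ) < G.D := by exact_mod_cast G.degree_pos
  have h1 : 0 ≤ 2 * G.D * G.energy α f := by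
    rw [two_mul_degree_mul_energy]
    positivity
  exact nonneg_of_mul_nonneg_right h1 (by positivity)

lemma norm_sub_sq_le_of_edge {p q : (Fin d → ℤ) × Fin k} (h : G.mult p q ≠ 0)
    (α : UnitAddTorus (Fin d)) (f : Fin k → ℂ) :
    ‖mFourier p.1 α * f p.2 - mFourier q.1 α * f q.2‖ ^ 2 ≤ 2 * G.D * G.energy α f := by
  obtain ⟨x, i⟩ := p
  obtain ⟨y, j⟩ := q
  obtain ⟨z, rfl⟩ : ∃ z, y = x + z := ⟨y - x, by abel⟩
  rw [mult_add] at h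
  have h1 : ‖mFourier x α * f i - mFourier (x + z) α * f j‖ = ‖f i - mFourier z α * f j‖ := by
    rw [mFourier_add, mul_assoc, ← mul_sub, norm_mul, norm_mFourier_apply, one_mul]
  have h2 : (1 : ℝ) ≤ G.mult (0, i) (z, j) := by
    exact_mod_cast Nat.one_le_iff_ne_zero.2 h
  rw [two_mul_degree_mul_energy]
  simp only [h1]
  calc ‖f i - mFourier z α * f j‖ ^ 2
      ≤ (G.mult (0, i) (z, j) : ℝ) * ‖f i - mFourier z α * f j‖ ^ 2 :=
        le_mul_of_one_le_left (by positivity) h2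
    _ ≤ ∑ j, (G.mult (0, i) (z, j) : ℝ) * ‖f i - mFourier z α * f j‖ ^ 2 :=
        Finset.single_le_sum
          (f := fun j => (G.mult (0, i) (z, j) : ℝ) * ‖f i - mFourier z α * f j‖ ^ 2)
          (fun _ _ => by positivity) (Finset.mem_univ j)
    _ ≤ ∑ i, ∑ j, (G.mult (0, i) (z, j) : ℝ) * ‖f i - mFourier z α * f j‖ ^ 2 :=
        Finset.single_le_sum
          (f := fun i => ∑ j, (G.mult (0, i) (z, j) : ℝ) * ‖f i - mFourier z α * f j‖ ^ 2)
          (fun _ _ => by positivity) (Finset.mem_univ i)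
    _ ≤ _ := Finset.single_le_sum (f := fun z => ∑ i, ∑ j,
          (G.mult (0, i) (z, j) : ℝ) * ‖f i - mFourier z α * f j‖ ^ 2)
          (fun _ _ => by positivity) (mem_edgeShifts.2 ⟨i, j, h⟩)

/-- Summing along a path, the energy controls the oscillation of the quasi-periodic function
`(x, i) ↦ ξ^α(x) f(i)` between any two vertices, uniformly in `α`. -/
lemma exists_norm_sub_sq_le (p q : (Fin d → ℤ) × Fin k) : ∃ L : ℝ, 0 ≤ L ∧
    ∀ (α : UnitAddTorus (Fin d)) (f : Fin k → ℂ),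
      ‖mFourier p.1 α * f p.2 - mFourier q.1 α * f q.2‖ ^ 2 ≤ L * G.energy α f := by
  induction G.connected p q with
  | refl => exact ⟨0, le_rfl, by simp⟩
  | @tail b c _ hbc ih =>
    obtain ⟨L, hL, h⟩ := ih
    refine ⟨2 * (L + 2 * G.D), by positivity, fun α f => ?_⟩
    have h1 := h α f
    have h2 := G.norm_sub_sq_le_of_edge hbc α f
    set u := mFourier p.1 α * f p.2
    set v := mFourier b.1 α * f b.2
    set w := mFourier c.1 α * f c.2
    have h3 : ‖u - w‖ ≤ ‖u - v‖ + ‖v - w‖ := norm_sub_le_norm_sub_add_norm_sub u v w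
    have h4 : ‖u - w‖ ^ 2 ≤ (‖u - v‖ + ‖v - w‖) ^ 2 := by gcongr
    nlinarith [sq_nonneg (‖u - v‖ - ‖v - w‖)]

/-- Coercivity of `1 - Q(α)`: translating a vertex by a unit vector shows that the form is at
least of order `‖α‖ ^ 2`, and joining vertices of the fundamental cell shows that it is bounded
below off the constants. -/
lemma exists_energy_lower_bound (hd : 1 ≤ d) : ∃ c : ℝ, 0 < c ∧
    (∀ (α : UnitAddTorus (Fin d)) (f : Fin k → ℂ),
      c * ‖α‖ ^ 2 * ∑ i, ‖f i‖ ^ 2 ≤ G.energy α f) ∧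
    (∀ (α : UnitAddTorus (Fin d)) (f : Fin k → ℂ), ∑ i, f i = 0 →
      c * ∑ i, ‖f i‖ ^ 2 ≤ G.energy α f) ∧
    ∀ (α : UnitAddTorus (Fin d)) (f : Fin k → ℂ) (i j : Fin k),
      c * ‖f i - f j‖ ^ 2 ≤ G.energy α f := by
  have hk : 0 < k := Fin.pos_iff_nonempty.2 G.nonempty_index
  have hk1 : (1 : ℝ) ≤ k := by exact_mod_cast hk
  choose L hL0 hL using fun p q => G.exists_norm_sub_sq_le p q
  set K : ℝ := 1 + ∑ i, ∑ j, L (0, i) (0, j) + ∑ i, ∑ m, L (0, i) (Pi.single m 1, i) with hKdef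
  have hA : 0 ≤ ∑ i, ∑ j, L (0, i) (0, j) :=
    Finset.sum_nonneg fun _ _ => Finset.sum_nonneg fun _ _ => hL0 _ _
  have hB : 0 ≤ ∑ i, ∑ m, L (0, i) (Pi.single m 1, i) :=
    Finset.sum_nonneg fun _ _ => Finset.sum_nonneg fun _ _ => hL0 _ _
  have hK : 0 < K := by positivity
  have hKcell : ∀ i j, L (0, i) (0, j) ≤ K := by
    intro i j
    have h1 : L (0, i) (0, j) ≤ ∑ j, L (0, i) (0, j) :=
      Finset.single_le_sum (f := fun j => L (0, i) (0, j)) (fun _ _ => hL0 _ _) (Finset.mem_univ j)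
    have h2 : ∑ j, L (0, i) (0, j) ≤ ∑ i, ∑ j, L (0, i) (0, j) :=
      Finset.single_le_sum (f := fun i => ∑ j, L (0, i) (0, j))
        (fun _ _ => Finset.sum_nonneg fun _ _ => hL0 _ _) (Finset.mem_univ i)
    linarith
  have hKshift : ∀ i m, L (0, i) (Pi.single m 1, i) ≤ K := by
    intro i m
    have h1 : L (0, i) (Pi.single m 1, i) ≤ ∑ m, L (0, i) (Pi.single m 1, i) :=
      Finset.single_le_sum (f := fun m => L (0, i) (Pi.single m 1, i))
        (fun _ _ => hL0 _ _) (Finset.mem_univ m)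
    have h2 : ∑ m, L (0, i) (Pi.single m 1, i) ≤ ∑ i, ∑ m, L (0, i) (Pi.single m 1, i) :=
      Finset.single_le_sum (f := fun i => ∑ m, L (0, i) (Pi.single m 1, i))
        (fun _ _ => Finset.sum_nonneg fun _ _ => hL0 _ _) (Finset.mem_univ i)
    linarith
  have hcell : ∀ (α : UnitAddTorus (Fin d)) (f : Fin k → ℂ) (i j : Fin k),
      ‖f i - f j‖ ^ 2 ≤ K * G.energy α f := by
    intro α f i j
    have h1 := hL (0, i) (0, j) α f
    simp only [mFourier_zero, ContinuousMap.one_apply, one_mul] at h1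
    exact h1.trans (mul_le_mul_of_nonneg_right (hKcell i j) (G.energy_nonneg α f))
  -- the shift by the unit vector in the direction of the largest coordinate of `α`
  have hshift : ∀ (α : UnitAddTorus (Fin d)) (f : Fin k → ℂ) (i : Fin k),
      ‖α‖ ^ 2 * ‖f i‖ ^ 2 ≤ K * G.energy α f := by
    intro α f i
    have : Nonempty (Fin d) := ⟨⟨0, hd⟩⟩
    obtain ⟨m, hm⟩ := Finite.exists_max fun m => ‖α m‖
    have h1 := hL (0, i) (Pi.single m 1, i) α f
    simp only [mFourier_zero, ContinuousMap.one_apply, one_mul] at h1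
    rw [mFourier_single] at h1
    have h2 : ‖f i - fourier 1 (α m) * f i‖ = ‖(fourier 1 (α m) : ℂ) - 1‖ * ‖f i‖ := by
      rw [← norm_mul, ← norm_neg]
      congr 1
      ring
    have h3 : ‖α‖ ≤ ‖(fourier 1 (α m) : ℂ) - 1‖ := by
      have h4 : ‖α‖ ≤ ‖α m‖ := (pi_norm_le_iff_of_nonneg (norm_nonneg _)).2 hm
      have h5 := (norm_fourier_one_sub_one (α m)).1
      have h6 := norm_nonneg (α m)
      linarith
    have h7 : ‖α‖ ^ 2 * ‖f i‖ ^ 2 ≤ ‖(fourier 1 (α m) : ℂ) - 1‖ ^ 2 * ‖f i‖ ^ 2 := by gcongr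
    rw [h2, mul_pow] at h1
    exact (h7.trans h1).trans (mul_le_mul_of_nonneg_right (hKshift i m) (G.energy_nonneg α f))
  have hzero : ∀ (α : UnitAddTorus (Fin d)) (f : Fin k → ℂ), ∑ i, f i = 0 → ∀ i,
      ‖f i‖ ^ 2 ≤ K * G.energy α f := by
    intro α f hf i
    have h1 : (k : ℂ) * f i = ∑ j, (f i - f j) := by
      rw [Finset.sum_sub_distrib, hf]
      simp
    have h2 : (k : ℝ) * ‖f i‖ ≤ ∑ j, ‖f i - f j‖ := by
      have := congrArg norm h1
      rw [norm_mul, Complex.norm_natCast] at this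
      rw [this]
      exact norm_sum_le _ _
    have h3 : ((k : ℝ) * ‖f i‖) ^ 2 ≤ (∑ j, ‖f i - f j‖) ^ 2 := by gcongr
    have h4 : (∑ j, ‖f i - f j‖) ^ 2 ≤ (k : ℝ) * ∑ j, ‖f i - f j‖ ^ 2 := by
      simpa using sq_sum_le_card_mul_sum_sq (s := Finset.univ) (f := fun j => ‖f i - f j‖)
    have h5 : ∑ j, ‖f i - f j‖ ^ 2 ≤ k * (K * G.energy α f) := by
      have := Finset.sum_le_sum fun j (_ : j ∈ Finset.univ) => hcell α f i j
      simpa using this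
    have h6 : (k : ℝ) ^ 2 * ‖f i‖ ^ 2 ≤ (k : ℝ) ^ 2 * (K * G.energy α f) := by
      have := mul_le_mul_of_nonneg_left h5 (by positivity : (0 : ℝ) ≤ k)
      nlinarith
    exact le_of_mul_le_mul_left h6 (by positivity)
  refine ⟨(k * K)⁻¹, by positivity, fun α f => ?_, fun α f hf => ?_, fun α f i j => ?_⟩
  · rw [mul_assoc, inv_mul_le_iff₀ (by positivity), Finset.mul_sum, mul_assoc]
    simpa using Finset.sum_le_sum fun i (_ : i ∈ Finset.univ) => hshift α f i
  · rw [inv_mul_le_iff₀ (by positivity), mul_assoc]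
    simpa using Finset.sum_le_sum fun i (_ : i ∈ Finset.univ) => hzero α f hf i
  · rw [inv_mul_le_iff₀ (by positivity), mul_assoc]
    refine (hcell α f i j).trans (le_mul_of_one_le_left ?_ hk1)
    exact mul_nonneg hK.le (G.energy_nonneg α f)

/-! ### Determinant and adjugate of `1 - Q(α)` -/

lemma sum_norm_sq_eq {n : Type*} [Fintype n] (x : EuclideanSpace ℂ n) :
    ∑ i, ‖x.ofLp i‖ ^ 2 = ‖x‖ ^ 2 := (EuclideanSpace.norm_sq_eq x).symm

lemma re_star_dotProduct_eq {n : Type*} [Fintype n] {M : Matrix n n ℂ} (x y : EuclideanSpace ℂ n)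
    (h : M *ᵥ x.ofLp = y.ofLp) : star x.ofLp ⬝ᵥ M *ᵥ x.ofLp = inner ℂ x y := by
  rw [h, EuclideanSpace.inner_eq_star_dotProduct, dotProduct_comm]

/-- If the form of a Hermitian matrix is at least `r` on all unit vectors and at least `c ≥ r` on
those with vanishing coordinate sum, then at most one eigenvalue lies below `c`, because a
combination of two eigenvectors has vanishing coordinate sum. -/
lemma mul_pow_le_re_det {n : Type*} [Fintype n] [DecidableEq n] [Nonempty n] {M : Matrix n n ℂ}
    (hM : M.IsHermitian) {r c : ℝ} (hr : 0 ≤ r) (hc : 0 < c)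
    (h1 : ∀ f : n → ℂ, r * ∑ i, ‖f i‖ ^ 2 ≤ (star f ⬝ᵥ M *ᵥ f).re)
    (h2 : ∀ f : n → ℂ, ∑ i, f i = 0 → c * ∑ i, ‖f i‖ ^ 2 ≤ (star f ⬝ᵥ M *ᵥ f).re) :
    r * c ^ (Fintype.card n - 1) ≤ M.det.re ∧ M.det.im = 0 := by
  set b := hM.eigenvectorBasis
  set μ := hM.eigenvalues
  have hdet : M.det = ((∏ i, μ i : ℝ) : ℂ) := by
    rw [hM.det_eq_prod_eigenvalues]
    push_cast
    rfl
  have hb : ∀ a, M *ᵥ (b a).ofLp = ((μ a : ℂ) • b a).ofLp := by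
    intro a
    rw [hM.mulVec_eigenvectorBasis a]
    rfl
  have hform : ∀ a, (star (b a).ofLp ⬝ᵥ M *ᵥ (b a).ofLp).re = μ a := by
    intro a
    rw [re_star_dotProduct_eq _ _ (hb a), inner_smul_right]
    simp
  have hmin : ∀ a, r ≤ μ a := by
    intro a
    have := h1 (b a).ofLp
    rw [sum_norm_sq_eq, hform] at this
    simpa using this
  have htwo : ∀ a a', a ≠ a' → μ a ≤ μ a' → c ≤ μ a' := by
    intro a a' haa hle
    set s : ℂ := ∑ i, (b a').ofLp i
    set t : ℂ := ∑ i, (b a).ofLp i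
    by_cases hs : s = 0
    · have := h2 (b a').ofLp hs
      rw [sum_norm_sq_eq, hform] at this
      simpa using this
    -- the coordinate sums `s`, `t` of the eigenvectors are crossed over to make that of `x` vanish
    · set x : EuclideanSpace ℂ n := s • b a - t • b a' with hx
      have hMx : M *ᵥ x.ofLp = ((s * μ a) • b a - (t * μ a') • b a').ofLp := by
        have hx' : x.ofLp = s • (b a).ofLp - t • (b a').ofLp := rfl
        rw [hx', mulVec_sub, mulVec_smul, mulVec_smul, hb, hb, mul_smul, mul_smul]
        rfl
      have hin : ∀ p q, inner ℂ (b p) (b q) = if p = q then (1 : ℂ) else 0 :=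
        orthonormal_iff_ite.1 b.orthonormal
      have hval : (star x.ofLp ⬝ᵥ M *ᵥ x.ofLp).re = μ a * ‖s‖ ^ 2 + μ a' * ‖t‖ ^ 2 := by
        rw [re_star_dotProduct_eq _ _ hMx, hx]
        simp only [inner_sub_left, inner_sub_right, inner_smul_left, inner_smul_right, hin,
          if_neg haa, if_neg haa.symm, if_true]
        simp only [← Complex.normSq_eq_norm_sq, Complex.normSq_apply]
        simp
        ring
      have hnorm : ‖x‖ ^ 2 = ‖s‖ ^ 2 + ‖t‖ ^ 2 := by
        rw [← inner_self_eq_norm_sq (𝕜 := ℂ) x, hx]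
        simp only [inner_sub_left, inner_sub_right, inner_smul_left, inner_smul_right, hin,
          if_neg haa, if_neg haa.symm, if_true]
        simp only [← Complex.normSq_eq_norm_sq, Complex.normSq_apply]
        simp
      have hsum : ∑ i, x.ofLp i = 0 := by
        have hx' : ∀ i, x.ofLp i = s * (b a).ofLp i - t * (b a').ofLp i := fun _ => rfl
        simp only [hx', Finset.sum_sub_distrib, ← Finset.mul_sum]
        exact sub_eq_zero.2 (mul_comm _ _)
      have h3 := h2 x.ofLp hsum
      rw [sum_norm_sq_eq, hval, hnorm] at h3
      have hspos : 0 < ‖s‖ ^ 2 := by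
        have := norm_pos_iff.2 hs
        positivity
      have h4 : μ a * ‖s‖ ^ 2 ≤ μ a' * ‖s‖ ^ 2 := by gcongr
      have h5 : c * (‖s‖ ^ 2 + ‖t‖ ^ 2) ≤ μ a' * (‖s‖ ^ 2 + ‖t‖ ^ 2) := by linarith
      exact le_of_mul_le_mul_right h5 (by positivity)
  refine ⟨?_, by rw [hdet, Complex.ofReal_im]⟩
  obtain ⟨a, ha⟩ := Finite.exists_min μ
  rw [hdet, Complex.ofReal_re, ← Finset.mul_prod_erase _ _ (Finset.mem_univ a)]
  refine mul_le_mul (hmin a) ?_ (by positivity) (hr.trans (hmin a))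
  have hcard : (Finset.univ.erase a).card = Fintype.card n - 1 := by
    rw [Finset.card_erase_of_mem (Finset.mem_univ a), Finset.card_univ]
  rw [← hcard, ← Finset.prod_const]
  exact Finset.prod_le_prod (fun _ _ => hc.le) fun i hi =>
    htwo a i (Finset.ne_of_mem_erase hi).symm (ha i)

lemma det_mem_of_forall_mem {n R A : Type*} [Fintype n] [DecidableEq n] [CommRing R] [CommRing A]
    [Algebra R A] {S : Subalgebra R A} {M : Matrix n n A} (h : ∀ i j, M i j ∈ S) : M.det ∈ S := by
  rw [det_apply]
  exact sum_mem fun σ _ => zsmul_mem (prod_mem fun i _ => h _ _) _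

/-- The symbol `Q`, as a matrix of trigonometric polynomials. -/
noncomputable def symbolPoly : Matrix (Fin k) (Fin k) C(UnitAddTorus (Fin d), ℂ) :=
  Matrix.of fun i j => (G.D : ℝ)⁻¹ • ∑ z ∈ G.edgeShifts, (G.mult (0, i) (z, j) : ℝ) • mFourier z

lemma map_one_sub_symbolPoly (α : UnitAddTorus (Fin d)) :
    (ContinuousMap.evalAlgHom ℂ ℂ α).mapMatrix (1 - G.symbolPoly) = 1 - G.symbol α := by
  rw [map_sub, map_one]
  congr 1
  ext i j
  rw [symbol_apply, AlgHom.mapMatrix_apply, Matrix.map_apply, symbolPoly, Matrix.of_apply,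
    ContinuousMap.evalAlgHom_apply]
  simp only [ContinuousMap.smul_apply, ContinuousMap.sum_apply, Complex.real_smul]
  push_cast
  congr 1
  exact Finset.sum_congr rfl fun z _ => mul_comm _ _

lemma one_sub_symbolPoly_mem (i j : Fin k) : (1 - G.symbolPoly) i j ∈ realTrigPoly d := by
  rw [Matrix.sub_apply, Matrix.one_apply]
  refine sub_mem (by split_ifs; exacts [one_mem _, zero_mem _]) ?_
  exact Subalgebra.smul_mem _ (sum_mem fun z _ =>
    Subalgebra.smul_mem _ (mFourier_mem_realTrigPoly z) _) _

/-- The trigonometric polynomial `det (1 - Q)`. -/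
noncomputable def detPoly : C(UnitAddTorus (Fin d), ℂ) := (1 - G.symbolPoly).det

/-- The entries of the adjugate of `1 - Q`, as trigonometric polynomials. -/
noncomputable def adjPoly (i j : Fin k) : C(UnitAddTorus (Fin d), ℂ) :=
  (1 - G.symbolPoly).adjugate i j

lemma detPoly_mem : G.detPoly ∈ realTrigPoly d :=
  det_mem_of_forall_mem G.one_sub_symbolPoly_mem

lemma adjPoly_mem (i j : Fin k) : G.adjPoly i j ∈ realTrigPoly d := by
  rw [adjPoly, adjugate_apply]
  refine det_mem_of_forall_mem fun a b => ?_
  rw [updateRow_apply, Pi.single_apply]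
  split_ifs
  exacts [one_mem _, zero_mem _, G.one_sub_symbolPoly_mem a b]

lemma detPoly_apply (α : UnitAddTorus (Fin d)) : G.detPoly α = (1 - G.symbol α).det := by
  rw [← map_one_sub_symbolPoly, ← AlgHom.map_det]
  rfl

lemma adjPoly_apply (i j : Fin k) (α : UnitAddTorus (Fin d)) :
    G.adjPoly i j α = (1 - G.symbol α).adjugate i j := by
  rw [← map_one_sub_symbolPoly, ← AlgHom.map_adjugate]
  rfl

lemma exists_detPoly_lower_bound (hd : 1 ≤ d) : ∃ c : ℝ, 0 < c ∧
    (∀ α, c * ‖α‖ ^ 2 ≤ (G.detPoly α).re) ∧ ∀ α, (G.detPoly α).im = 0 := by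
  obtain ⟨c, hc, h1, h2, -⟩ := G.exists_energy_lower_bound hd
  have := G.nonempty_index
  have key := fun α => mul_pow_le_re_det (M := 1 - G.symbol α) (r := c * ‖α‖ ^ 2)
    (isHermitian_one.sub (G.isHermitian_symbol α)) (by positivity) hc (h1 α) (h2 α)
  refine ⟨c * c ^ (Fintype.card (Fin k) - 1), by positivity, fun α => ?_, fun α => ?_⟩
  · rw [detPoly_apply, mul_right_comm]
    exact (key α).1
  · rw [detPoly_apply]
    exact (key α).2

lemma symbol_zero_mulVec_one : (1 - G.symbol 0) *ᵥ 1 = 0 := by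
  have hD : (G.D : ℂ) ≠ 0 := by exact_mod_cast G.degree_pos.ne'
  ext i
  rw [sub_mulVec, one_mulVec, Pi.sub_apply]
  simp only [mulVec, dotProduct, symbol_apply, mFourier_apply_zero, one_mul, Pi.one_apply, mul_one,
    ← Finset.mul_sum]
  rw [Finset.sum_comm]
  have := congrArg (Nat.cast (R := ℂ)) (G.sum_mult i)
  push_cast at this
  rw [this, inv_mul_cancel₀ hD, sub_self]
  rfl

lemma det_one_sub_symbol_zero : (1 - G.symbol 0).det = 0 := by
  have := G.nonempty_index
  exact exists_mulVec_eq_zero_iff.1 ⟨1, one_ne_zero, G.symbol_zero_mulVec_one⟩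

lemma detPoly_apply_zero : G.detPoly 0 = 0 := by
  rw [detPoly_apply, det_one_sub_symbol_zero]

/-- The kernel of `1 - Q(0)` consists of the constants, so the rows of its adjugate are constant. -/
lemma adjPoly_apply_zero_eq (hd : 1 ≤ d) (i j j' : Fin k) :
    G.adjPoly i j 0 = G.adjPoly i j' 0 := by
  obtain ⟨c, hc, -, -, h3⟩ := G.exists_energy_lower_bound hd
  have hH : (1 - G.symbol 0).IsHermitian := isHermitian_one.sub (G.isHermitian_symbol 0)
  rw [adjPoly_apply, adjPoly_apply]
  set f : Fin k → ℂ := fun j => star ((1 - G.symbol 0).adjugate i j) with hf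
  have hker : (1 - G.symbol 0) *ᵥ f = 0 := by
    have h0 : (1 - G.symbol 0).adjugate * (1 - G.symbol 0) = 0 := by
      rw [adjugate_mul, det_one_sub_symbol_zero, zero_smul]
    ext l
    have h4 := congrArg star (congrFun (congrFun h0 i) l)
    rw [Matrix.mul_apply, star_sum] at h4
    simp only [star_mul', Matrix.zero_apply, star_zero] at h4
    rw [Pi.zero_apply, ← h4]
    simp only [mulVec, dotProduct]
    refine Finset.sum_congr rfl fun j _ => ?_
    rw [hH.apply, mul_comm]
  have hE : G.energy 0 f = 0 := by
    rw [energy, hker, dotProduct_zero, Complex.zero_re]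
  have h5 := h3 0 f j j'
  rw [hE] at h5
  have h6 : ‖f j - f j'‖ ^ 2 ≤ 0 := nonpos_of_mul_nonpos_right h5 hc
  have h7 : f j - f j' = 0 :=
    norm_eq_zero.1 (pow_eq_zero_iff two_ne_zero |>.1 (le_antisymm h6 (by positivity)))
  exact star_injective (sub_eq_zero.1 h7)

/-! ### The integrands of the Green functions -/

variable {G}
  {v : UnitAddTorus (Fin d) → OrthonormalBasis (Fin k) ℂ (EuclideanSpace ℂ (Fin k))}
  {lam : UnitAddTorus (Fin d) → Fin k → ℝ}

/-- The vector `∑_i c^u(α, i) (1 - λ(α, i))⁻¹ v(α, i)`, which is `(1 - Q(α))⁻¹ u` for `α ≠ 0`. -/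
noncomputable def resolventVec
    (v : UnitAddTorus (Fin d) → OrthonormalBasis (Fin k) ℂ (EuclideanSpace ℂ (Fin k)))
    (lam : UnitAddTorus (Fin d) → Fin k → ℝ) (u : Fin k → ℂ) (α : UnitAddTorus (Fin d)) :
    Fin k → ℂ :=
  ∑ i, (coeff (v α) u i * (1 - (lam α i : ℂ))⁻¹) • (v α i).ofLp

lemma one_sub_eigenvalue_ne_zero (hd : 1 ≤ d) (hv : G.IsEigenSelection v lam)
    {α : UnitAddTorus (Fin d)}
    (hα : α ≠ 0) (i : Fin k) : (1 - (lam α i : ℂ)) ≠ 0 := by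
  obtain ⟨c, hc, h1, -⟩ := G.exists_energy_lower_bound hd
  have h2 := h1 α (v α i).ofLp
  have h3 : (1 - G.symbol α) *ᵥ (v α i).ofLp = ((1 - (lam α i : ℂ)) • v α i).ofLp := by
    rw [sub_mulVec, one_mulVec, hv α i, sub_smul, one_smul]
    rfl
  intro h0
  rw [energy, sum_norm_sq_eq, re_star_dotProduct_eq _ _ h3, h0, zero_smul, inner_zero_right,
    OrthonormalBasis.norm_eq_one] at h2
  have h4 : 0 < ‖α‖ := norm_pos_iff.2 hα
  have h5 : 0 < c * ‖α‖ ^ 2 := by positivity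
  simp at h2
  linarith

lemma one_sub_symbol_mulVec_resolventVec (hd : 1 ≤ d) (hv : G.IsEigenSelection v lam)
    (u : Fin k → ℂ) {α : UnitAddTorus (Fin d)} (hα : α ≠ 0) :
    (1 - G.symbol α) *ᵥ resolventVec v lam u α = u := by
  have h1 : ∀ i, (1 - G.symbol α) *ᵥ
      ((coeff (v α) u i * (1 - (lam α i : ℂ))⁻¹) • (v α i).ofLp) =
      coeff (v α) u i • (v α i).ofLp := by
    intro i
    rw [mulVec_smul, sub_mulVec, one_mulVec, hv α i]
    have h2 := one_sub_eigenvalue_ne_zero hd hv hα i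
    ext l
    simp only [Pi.smul_apply, Pi.sub_apply, smul_eq_mul]
    field_simp
  rw [resolventVec, mulVec_sum, Finset.sum_congr rfl fun i _ => h1 i]
  have h3 := congrArg WithLp.ofLp ((v α).sum_repr' (WithLp.toLp 2 u))
  rw [WithLp.ofLp_sum] at h3
  exact h3

/-- Cramer's rule for `resolventVec`. -/
lemma detPoly_mul_resolventVec (hd : 1 ≤ d) (hv : G.IsEigenSelection v lam)
    (u : Fin k → ℂ) {α : UnitAddTorus (Fin d)} (hα : α ≠ 0) (i : Fin k) :
    G.detPoly α * resolventVec v lam u α i = ∑ j, G.adjPoly i j α * u j := by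
  have h1 := congrArg (fun w => ((1 - G.symbol α).adjugate *ᵥ w) i)
    (one_sub_symbol_mulVec_resolventVec hd hv u hα)
  simp only [mulVec_mulVec, adjugate_mul, smul_mulVec, one_mulVec] at h1
  rw [detPoly_apply]
  simp only [adjPoly_apply]
  exact h1

/-- The integrand with a multiplier `m`: it is `greenIntegrand` for `m = 1`, and
`greenDiffIntegrand` for `m(α) = 1 - exp (-2 π i α_j)`. -/
noncomputable def multiplierIntegrand
    (v : UnitAddTorus (Fin d) → OrthonormalBasis (Fin k) ℂ (EuclideanSpace ℂ (Fin k)))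
    (lam : UnitAddTorus (Fin d) → Fin k → ℝ) (u : Fin k → ℂ) (m : C(UnitAddTorus (Fin d), ℂ))
    (p : (Fin d → ℤ) × Fin k) (α : UnitAddTorus (Fin d)) : ℝ :=
  (m α * resolventVec v lam u α p.2 * mFourier p.1 α).re

lemma greenIntegrand_eq (u : Fin k → ℂ) :
    greenIntegrand v lam u = multiplierIntegrand v lam u 1 := by
  funext p α
  simp only [greenIntegrand, multiplierIntegrand, resolventVec, tensor, character,
    ContinuousMap.one_apply, one_mul, Finset.sum_apply, Pi.smul_apply, smul_eq_mul,
    Finset.sum_mul, Complex.re_sum]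
  refine Finset.sum_congr rfl fun i _ => congrArg Complex.re ?_
  ring

lemma fourier_neg_one_eq_mFourier (α : UnitAddTorus (Fin d)) (j : Fin d) :
    (fourier (-1) (α j) : ℂ) = mFourier (-Pi.single j 1) α := by
  rw [mFourier_neg, mFourier_single, fourier_neg]

lemma greenDiffIntegrand_eq (u : Fin k → ℂ) (j : Fin d) :
    greenDiffIntegrand v lam u j =
      multiplierIntegrand v lam u (1 - mFourier (-Pi.single j 1)) := by
  funext p α
  simp only [greenDiffIntegrand, multiplierIntegrand, resolventVec, tensor, character,
    ContinuousMap.sub_apply, ContinuousMap.one_apply, Finset.sum_apply, Pi.smul_apply, smul_eq_mul,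
    Finset.sum_mul, Finset.mul_sum, Complex.re_sum, fourier_neg_one_eq_mFourier]
  refine Finset.sum_congr rfl fun i _ => congrArg Complex.re ?_
  ring

variable (G) in
/-- The numerator, by Cramer's rule, of the integrand with multiplier `m` at a real vector `a`. -/
noncomputable def numerator (m : C(UnitAddTorus (Fin d), ℂ)) (a : Fin k → ℝ) (i : Fin k) :
    C(UnitAddTorus (Fin d), ℂ) :=
  m * ∑ j, a j • G.adjPoly i j

lemma numerator_mem {m : C(UnitAddTorus (Fin d), ℂ)} (hm : m ∈ realTrigPoly d) (a : Fin k → ℝ)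
    (i : Fin k) : G.numerator m a i ∈ realTrigPoly d :=
  mul_mem hm (sum_mem fun j _ => Subalgebra.smul_mem _ (G.adjPoly_mem i j) _)

lemma numerator_apply (m : C(UnitAddTorus (Fin d), ℂ)) (a : Fin k → ℝ) (i : Fin k)
    (α : UnitAddTorus (Fin d)) :
    G.numerator m a i α = m α * ∑ j, (a j : ℂ) * G.adjPoly i j α := by
  simp [numerator]

lemma numerator_apply_zero (hd : 1 ≤ d) {m : C(UnitAddTorus (Fin d), ℂ)} {a : Fin k → ℝ}
    (h : m 0 = 0 ∨ ∑ i, a i = 0) (i : Fin k) : G.numerator m a i 0 = 0 := by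
  rw [numerator_apply]
  rcases h with h | h
  · rw [h, zero_mul]
  · rw [Finset.sum_congr rfl fun j _ => by rw [G.adjPoly_apply_zero_eq hd i j i],
      ← Finset.sum_mul, ← Complex.ofReal_sum, h, Complex.ofReal_zero, zero_mul, mul_zero]

lemma multiplierIntegrand_ae_eq (hd : 1 ≤ d) (hv : G.IsEigenSelection v lam)
    (u : Fin k → ℂ) (m : C(UnitAddTorus (Fin d), ℂ)) (p : (Fin d → ℤ) × Fin k) :
    multiplierIntegrand v lam u m p =ᵐ[torusHaar d] fun α =>
      ((G.numerator m (fun i => (u i).re) p.2 α +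
        Complex.I * G.numerator m (fun i => (u i).im) p.2 α) * mFourier p.1 α).re /
          (G.detPoly α).re := by
  obtain ⟨c, hc, hlow, him⟩ := G.exists_detPoly_lower_bound hd
  filter_upwards [ae_ne_zero hd] with α hα
  have h4 : 0 < ‖α‖ := norm_pos_iff.2 hα
  have h5 : 0 < (G.detPoly α).re := lt_of_lt_of_le (by positivity) (hlow α)
  have hre : G.detPoly α = ((G.detPoly α).re : ℂ) := Complex.ext rfl (by simp [him])
  have h6 := detPoly_mul_resolventVec hd hv u hα p.2
  have h7 : G.numerator m (fun i => (u i).re) p.2 α +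
      Complex.I * G.numerator m (fun i => (u i).im) p.2 α =
      m α * ∑ j, G.adjPoly p.2 j α * u j := by
    rw [numerator_apply, numerator_apply, mul_left_comm, ← mul_add, Finset.mul_sum,
      ← Finset.sum_add_distrib]
    congr 1
    refine Finset.sum_congr rfl fun j _ => ?_
    conv_rhs => rw [← Complex.re_add_im (u j)]
    ring
  rw [multiplierIntegrand, h7, ← h6, eq_div_iff h5.ne', mul_comm, ← Complex.re_ofReal_mul, ← hre]
  congr 1
  ring

lemma integrable_multiplierIntegrand_of_three_le (hd : 3 ≤ d) (hv : G.IsEigenSelection v lam)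
    (u : Fin k → ℂ) (m : C(UnitAddTorus (Fin d), ℂ)) (p : (Fin d → ℤ) × Fin k) :
    Integrable (multiplierIntegrand v lam u m p) (torusHaar d) := by
  have hd1 : 1 ≤ d := by omega
  obtain ⟨c, hc, hlow, -⟩ := G.exists_detPoly_lower_bound hd1
  refine Integrable.congr ?_ (multiplierIntegrand_ae_eq hd1 hv u m p).symm
  set H : C(UnitAddTorus (Fin d), ℂ) := G.numerator m (fun i => (u i).re) p.2 +
    Complex.I • G.numerator m (fun i => (u i).im) p.2
  refine integrable_div_of_abs_le (m := 0) (C := ‖H‖) hd1 (by fun_prop) (by fun_prop) hc hlow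
    (by norm_num) (by omega) fun α => ?_
  rw [pow_zero, mul_one]
  refine (Complex.abs_re_le_norm _).trans ?_
  rw [norm_mul, norm_mFourier_apply, mul_one]
  exact H.norm_coe_le_norm α

lemma integrable_multiplierIntegrand_of_two_le (hd : 2 ≤ d) (hv : G.IsEigenSelection v lam)
    {u : Fin k → ℂ} {m : C(UnitAddTorus (Fin d), ℂ)} (hm : m ∈ realTrigPoly d)
    (h : m 0 = 0 ∨ ∑ i, u i = 0) (p : (Fin d → ℤ) × Fin k) :
    Integrable (multiplierIntegrand v lam u m p) (torusHaar d) := by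
  have hd1 : 1 ≤ d := by omega
  obtain ⟨c, hc, hlow, -⟩ := G.exists_detPoly_lower_bound hd1
  refine Integrable.congr ?_ (multiplierIntegrand_ae_eq hd1 hv u m p).symm
  have hre : m 0 = 0 ∨ ∑ i, (u i).re = 0 := h.imp_right fun h => by
    rw [← Complex.re_sum, h, Complex.zero_re]
  have him : m 0 = 0 ∨ ∑ i, (u i).im = 0 := h.imp_right fun h => by
    rw [← Complex.im_sum, h, Complex.zero_im]
  obtain ⟨K, -, hK⟩ :=
    exists_norm_sub_apply_zero_le (numerator_mem (G := G) hm (fun i => (u i).re) p.2)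
  obtain ⟨K', -, hK'⟩ :=
    exists_norm_sub_apply_zero_le (numerator_mem (G := G) hm (fun i => (u i).im) p.2)
  rw [numerator_apply_zero hd1 hre] at hK
  rw [numerator_apply_zero hd1 him] at hK'
  simp only [sub_zero] at hK hK'
  refine integrable_div_of_abs_le (m := 1) (C := K + K') hd1 (by fun_prop) (by fun_prop) hc hlow
    (by norm_num) (by omega) fun α => ?_
  refine (Complex.abs_re_le_norm _).trans ?_
  rw [norm_mul, norm_mFourier_apply, mul_one, pow_one, add_mul]
  refine (norm_add_le _ _).trans (add_le_add (hK α) ?_)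
  rw [norm_mul, Complex.norm_I, one_mul]
  exact hK' α

/-- For real `u` the numerator is a cosine polynomial, so it vanishes to second order when it
vanishes, and the integrand is bounded. -/
lemma integrable_multiplierIntegrand_of_real (hd : 1 ≤ d) (hv : G.IsEigenSelection v lam)
    {u : Fin k → ℂ} (hu : ∀ i, (u i).im = 0) {m : C(UnitAddTorus (Fin d), ℂ)}
    (hm : m ∈ realTrigPoly d) (h : m 0 = 0 ∨ ∑ i, u i = 0) (p : (Fin d → ℤ) × Fin k) :
    Integrable (multiplierIntegrand v lam u m p) (torusHaar d) := by
  obtain ⟨c, hc, hlow, -⟩ := G.exists_detPoly_lower_bound hd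
  refine Integrable.congr ?_ (multiplierIntegrand_ae_eq hd hv u m p).symm
  have hre : m 0 = 0 ∨ ∑ i, (u i).re = 0 := h.imp_right fun h => by
    rw [← Complex.re_sum, h, Complex.zero_re]
  obtain ⟨K, -, hK⟩ := exists_abs_re_sub_re_apply_zero_le
    (mul_mem (numerator_mem (G := G) hm (fun i => (u i).re) p.2) (mFourier_mem_realTrigPoly p.1))
  rw [ContinuousMap.mul_apply, numerator_apply_zero hd hre, zero_mul] at hK
  have him : ∀ α, G.numerator m (fun i => (u i).im) p.2 α = 0 := by
    intro α
    simp [numerator_apply, hu]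
  simp only [him, mul_zero, add_zero]
  refine integrable_div_of_abs_le (m := 2) (C := K) hd (by fun_prop) (by fun_prop) hc hlow
    le_rfl (by omega) fun α => ?_
  simpa using hK α

lemma exists_abs_integral_multiplierIntegrand_le (hd : 1 ≤ d) (hv : G.IsEigenSelection v lam)
    {u : Fin k → ℂ} {m : C(UnitAddTorus (Fin d), ℂ)} (hm : m ∈ realTrigPoly d)
    (hint : ∀ p, Integrable (multiplierIntegrand v lam u m p) (torusHaar d)) :
    ∃ C : ℝ, ∀ p, |∫ α, multiplierIntegrand v lam u m p α ∂torusHaar d| ≤ C := by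
  obtain ⟨c, hc, hlow, him⟩ := G.exists_detPoly_lower_bound hd
  have key : ∀ i, ∃ C : ℝ, ∀ x,
      |∫ α, multiplierIntegrand v lam u m (x, i) α ∂torusHaar d| ≤ C := by
    intro i
    obtain ⟨C, hC⟩ := exists_abs_integral_le hd (numerator_mem (G := G) hm (fun i => (u i).re) i)
      (numerator_mem (G := G) hm (fun i => (u i).im) i) G.detPoly_mem G.detPoly_apply_zero him hc
      hlow fun x => (hint (x, i)).congr (multiplierIntegrand_ae_eq hd hv u m (x, i))
    refine ⟨C, fun x => ?_⟩
    rw [integral_congr_ae (multiplierIntegrand_ae_eq hd hv u m (x, i))]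
    exact hC x
  choose C hC using key
  refine ⟨∑ i, |C i|, fun p => ((hC p.2 p.1).trans (le_abs_self _)).trans ?_⟩
  exact Finset.single_le_sum (f := fun i => |C i|) (fun _ _ => abs_nonneg _) (Finset.mem_univ _)

/-- Away from `α = 0` the operator `I - A` turns the integrand at `(x, i)` into
`Re (m(α) u_i ξ^α(x))`. -/
lemma multiplierIntegrand_sub_sum (hd : 1 ≤ d) (hv : G.IsEigenSelection v lam) (u : Fin k → ℂ)
    (m : C(UnitAddTorus (Fin d), ℂ)) (x : Fin d → ℤ) (i : Fin k) {α : UnitAddTorus (Fin d)}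
    (hα : α ≠ 0) :
    multiplierIntegrand v lam u m (x, i) α - (G.D : ℝ)⁻¹ * ∑ z ∈ G.edgeShifts, ∑ j,
      (G.mult (0, i) (z, j) : ℝ) * multiplierIntegrand v lam u m (x + z, j) α =
      (u i * (m α * mFourier x α)).re := by
  have h1 : ∑ z ∈ G.edgeShifts, ∑ j, (G.mult (0, i) (z, j) : ℝ) *
      multiplierIntegrand v lam u m (x + z, j) α = (∑ z ∈ G.edgeShifts, ∑ j,
        (G.mult (0, i) (z, j) : ℂ) *
          (m α * resolventVec v lam u α j * mFourier (x + z) α)).re := by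
    simp only [Complex.re_sum, multiplierIntegrand, ← Complex.ofReal_natCast,
      Complex.re_ofReal_mul]
  have h2 := congrFun (one_sub_symbol_mulVec_resolventVec hd hv u hα) i
  rw [sub_mulVec, one_mulVec, Pi.sub_apply] at h2
  have h3 : (G.D : ℂ)⁻¹ * ∑ z ∈ G.edgeShifts, ∑ j, (G.mult (0, i) (z, j) : ℂ) *
      (m α * resolventVec v lam u α j * mFourier (x + z) α) =
      m α * mFourier x α * (G.symbol α *ᵥ resolventVec v lam u α) i := by
    simp only [mulVec, dotProduct, symbol_apply, Finset.mul_sum, Finset.sum_mul, mFourier_add]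
    rw [Finset.sum_comm]
    refine Finset.sum_congr rfl fun j _ => Finset.sum_congr rfl fun z _ => ?_
    ring
  rw [h1, ← Complex.re_ofReal_mul, multiplierIntegrand, ← Complex.sub_re, ← h2,
    Complex.ofReal_inv, Complex.ofReal_natCast, h3]
  congr 1
  ring

lemma integral_multiplierIntegrand_sub_adjacencyOp (hd : 1 ≤ d) (hv : G.IsEigenSelection v lam)
    (u : Fin k → ℂ) (m : C(UnitAddTorus (Fin d), ℂ))
    (hint : ∀ p, Integrable (multiplierIntegrand v lam u m p) (torusHaar d))
    (x : Fin d → ℤ) (i : Fin k) :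
    ((∫ α, multiplierIntegrand v lam u m (x, i) α ∂torusHaar d : ℝ) : ℂ) -
      G.adjacencyOp (fun p => ((∫ α, multiplierIntegrand v lam u m p α ∂torusHaar d : ℝ) : ℂ))
        (x, i) = ((u i * ∫ α, m α * mFourier x α ∂torusHaar d).re : ℂ) := by
  have hterm : ∀ z j, Integrable (fun α => (G.mult (0, i) (z, j) : ℝ) *
      multiplierIntegrand v lam u m (x + z, j) α) (torusHaar d) := fun z j =>
    (hint (x + z, j)).const_mul _
  have hsum : Integrable (fun α => (G.D : ℝ)⁻¹ * ∑ z ∈ G.edgeShifts, ∑ j,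
      (G.mult (0, i) (z, j) : ℝ) * multiplierIntegrand v lam u m (x + z, j) α) (torusHaar d) :=
    (integrable_finsetSum _ fun z _ => integrable_finsetSum _ fun j _ => hterm z j).const_mul _
  have hm : Integrable (fun α => m α * mFourier x α) (torusHaar d) :=
    Continuous.integrable_of_hasCompactSupport (by fun_prop) (HasCompactSupport.of_compactSpace _)
  have h1 : ∫ α, multiplierIntegrand v lam u m (x, i) α ∂torusHaar d -
      (G.D : ℝ)⁻¹ * ∑ z ∈ G.edgeShifts, ∑ j, (G.mult (0, i) (z, j) : ℝ) *
        ∫ α, multiplierIntegrand v lam u m (x + z, j) α ∂torusHaar d =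
      ∫ α, (u i * (m α * mFourier x α)).re ∂torusHaar d := by
    have h2 : (G.D : ℝ)⁻¹ * ∑ z ∈ G.edgeShifts, ∑ j, (G.mult (0, i) (z, j) : ℝ) *
        ∫ α, multiplierIntegrand v lam u m (x + z, j) α ∂torusHaar d =
        ∫ α, (G.D : ℝ)⁻¹ * ∑ z ∈ G.edgeShifts, ∑ j, (G.mult (0, i) (z, j) : ℝ) *
          multiplierIntegrand v lam u m (x + z, j) α ∂torusHaar d := by
      rw [integral_const_mul, integral_finsetSum _ fun z _ =>
        integrable_finsetSum _ fun j _ => hterm z j]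
      congr 1
      refine Finset.sum_congr rfl fun z _ => ?_
      rw [integral_finsetSum _ fun j _ => hterm z j]
      exact Finset.sum_congr rfl fun j _ => (integral_const_mul _ _).symm
    rw [h2, ← integral_sub (hint (x, i)) hsum]
    refine integral_congr_ae ?_
    filter_upwards [ae_ne_zero hd] with α hα
    exact multiplierIntegrand_sub_sum hd hv u m x i hα
  have h3 : ∫ α, (u i * (m α * mFourier x α)).re ∂torusHaar d =
      (u i * ∫ α, m α * mFourier x α ∂torusHaar d).re := by
    rw [← integral_const_mul]
    exact integral_re (hm.const_mul (u i))
  rw [← h3, ← h1, adjacencyOp_apply]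
  push_cast
  rfl

lemma integral_one_mul_mFourier (x : Fin d → ℤ) :
    ∫ α, (1 : C(UnitAddTorus (Fin d), ℂ)) α * mFourier x α ∂torusHaar d = delta 0 x := by
  simp only [ContinuousMap.one_apply, one_mul, integral_mFourier, delta, Pi.single_apply]

lemma integral_one_sub_mul_mFourier (j : Fin d) (x : Fin d → ℤ) :
    ∫ α, (1 - mFourier (-Pi.single j 1) : C(UnitAddTorus (Fin d), ℂ)) α * mFourier x α
      ∂torusHaar d = delta 0 x - delta (Pi.single j 1) x := by
  have h1 : ∀ n : Fin d → ℤ, Integrable (fun α => mFourier n α) (torusHaar d) := fun n =>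
    (mFourier n).continuous.integrable_of_hasCompactSupport (HasCompactSupport.of_compactSpace _)
  have h2 : ∀ α, (1 - mFourier (-Pi.single j 1) : C(UnitAddTorus (Fin d), ℂ)) α * mFourier x α =
      mFourier x α - mFourier (-Pi.single j 1 + x) α := by
    intro α
    rw [mFourier_add, ContinuousMap.sub_apply, ContinuousMap.one_apply, sub_mul, one_mul]
  simp only [h2]
  rw [integral_sub (h1 _) (h1 _), integral_mFourier, integral_mFourier]
  simp only [delta, Pi.single_apply, neg_add_eq_zero, eq_comm]

end PeriodicLattice

open PeriodicLattice in
theorem theorem2p2 {d k : ℕ} (hd : 1 ≤ d) (G : PeriodicLattice d k)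
    (v : UnitAddTorus (Fin d) → OrthonormalBasis (Fin k) ℂ (EuclideanSpace ℂ (Fin k)))
    (lam : UnitAddTorus (Fin d) → Fin k → ℝ) (hv : G.IsEigenSelection v lam)
    (u : Fin k → ℂ) :
    -- (i) integrability; for `d = 1` the function `u` has to be real
    ((∀ j : Fin d, (2 ≤ d ∨ ∀ i, (u i).im = 0) → ∀ p,
        Integrable (PeriodicLattice.greenDiffIntegrand v lam u j p)
          (PeriodicLattice.torusHaar d)) ∧
      ((3 ≤ d ∨ (d = 2 ∧ ∑ i, u i = 0) ∨ (d = 1 ∧ ∑ i, u i = 0 ∧ ∀ i, (u i).im = 0)) → ∀ p,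
        Integrable (PeriodicLattice.greenIntegrand v lam u p) (PeriodicLattice.torusHaar d))) ∧
    -- the case of `g^u` in (ii) and (iii); if `u` is real then `Re u = u`
    ((∀ p, Integrable (PeriodicLattice.greenIntegrand v lam u p)
        (PeriodicLattice.torusHaar d)) →
      ((fun p => (PeriodicLattice.green v lam u p : ℂ)) -
          G.adjacencyOp (fun p => (PeriodicLattice.green v lam u p : ℂ)) =
        PeriodicLattice.tensor (fun i => ((u i).re : ℂ)) (PeriodicLattice.delta 0)) ∧
      ∃ C : ℝ, ∀ p, |PeriodicLattice.green v lam u p| ≤ C) ∧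
    -- the case of `g^{u,j}` in (ii) and (iii)
    (∀ j : Fin d,
      (∀ p, Integrable (PeriodicLattice.greenDiffIntegrand v lam u j p)
        (PeriodicLattice.torusHaar d)) →
      ((fun p => (PeriodicLattice.greenDiff v lam u j p : ℂ)) -
          G.adjacencyOp (fun p => (PeriodicLattice.greenDiff v lam u j p : ℂ)) =
        PeriodicLattice.tensor (fun i => ((u i).re : ℂ))
          (PeriodicLattice.delta 0 - PeriodicLattice.delta (Pi.single j 1))) ∧
      ∃ C : ℝ, ∀ p, |PeriodicLattice.greenDiff v lam u j p| ≤ C) := by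
  have hm : ∀ j : Fin d, 1 - UnitAddTorus.mFourier (-Pi.single j 1) ∈ realTrigPoly d := fun j =>
    sub_mem (one_mem _) (mFourier_mem_realTrigPoly _)
  have hm0 : ∀ j : Fin d,
      (1 - UnitAddTorus.mFourier (-Pi.single j 1) : C(UnitAddTorus (Fin d), ℂ)) 0 = 0 := by
    intro j
    rw [ContinuousMap.sub_apply, mFourier_apply_zero, ContinuousMap.one_apply, sub_self]
  simp only [green, greenDiff, greenIntegrand_eq, greenDiffIntegrand_eq]
  refine ⟨⟨fun j h p => ?_, fun h p => ?_⟩, fun hint => ⟨?_, ?_⟩, fun j hint => ⟨?_, ?_⟩⟩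
  · rcases h with h | h
    · exact integrable_multiplierIntegrand_of_two_le h hv (hm j) (.inl (hm0 j)) p
    · exact integrable_multiplierIntegrand_of_real hd hv h (hm j) (.inl (hm0 j)) p
  · rcases h with h | ⟨rfl, h⟩ | ⟨rfl, h, hu⟩
    · exact integrable_multiplierIntegrand_of_three_le h hv u 1 p
    · exact integrable_multiplierIntegrand_of_two_le le_rfl hv (one_mem _) (.inr h) p
    · exact integrable_multiplierIntegrand_of_real le_rfl hv hu (one_mem _) (.inr h) p
  · funext ⟨x, i⟩
    refine (integral_multiplierIntegrand_sub_adjacencyOp hd hv u 1 hint x i).trans ?_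
    rw [integral_one_mul_mFourier, tensor, delta, Pi.single_apply]
    split_ifs <;> simp
  · exact exists_abs_integral_multiplierIntegrand_le hd hv (one_mem _) hint
  · funext ⟨x, i⟩
    refine (integral_multiplierIntegrand_sub_adjacencyOp hd hv u _ hint x i).trans ?_
    rw [integral_one_sub_mul_mFourier, tensor, Pi.sub_apply, delta, delta, Pi.single_apply,
      Pi.single_apply]
    split_ifs <;> simp
  · exact exists_abs_integral_multiplierIntegrand_le hd hv (hm j) hint
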